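/- Let $T$ be an operad (symmetric multicategory) with object set $I$: it has sets of arrows $\alpha:(i_j)_{1\le j\le n}\to i$, permutation actions $\alpha\mapsto\alpha\rho:(i_{\rho j})_j\to i$, identities $1_i:(i)\to i$ and substitutions $\alpha(\beta_j)_j$, satisfying the unit, associativity and equivariance axioms. Regard an object $H$ of $\mathbf{Cat}/I$ as a family $(H_i)_{i\in I}$ of small categories. The operad $T$ gives a 2-monad on $\mathbf{Cat}/I$, also denoted $T$. The objects of $(TX)_i$ are the labelled operations $(\alpha,(x_j)_j)$, with $\alpha:(i_j)_j\to i$ in $T$ and $x_j\in X_{i_j}$. A morphism $(\alpha,(x_j)_j)\to(\beta,(y_j)_j)$ consists of a permutation $\rho$ with $\alpha=\beta\rho$ and morphisms $\gamma_j:x_j\to y_{\rho j}$. The unit is $x\mapsto(1_i,(x))$ and the multiplication is $(\alpha,(\alpha_j,(x_{jk})_k)_j)\mapsto(\alpha(\alpha_j)_j,(x_{jk})_{jk})$. A lax morphism of operads $H:T\to\underline{\mathbf{Cat}}$ consists of categories $H_i$, functors $H_\alpha:\prod_jH_{i_j}\to H_i$, and natural transformations $\xi_{\alpha,\rho}:H_{\alpha\rho}c_\rho\to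 H_\alpha$ (where $c_\rho(x_j)_j=(x_{\rho j})_j$), $\nu_i:1_{H_i}\to H_{1_i}$ and $\sigma_{\alpha,(\beta_j)_j}:H_\alpha(\prod_jH_{\beta_j})\to H_{\alpha(\beta_j)_j}$, such that * $\xi_{\alpha,1}=\mathrm{id}$ and $\xi_{\alpha,\rho\tau}=\xi_{\alpha,\rho}\,(\xi_{\alpha\rho,\tau}c_\rho)$; * $\sigma_{\alpha,(1_{i_j})_j}\cdot H_\alpha(\prod_j\nu_{i_j})=\mathrm{id}$ and $\sigma_{1_i,(\alpha)}\cdot\nu_iH_\alpha=\mathrm{id}$; * $\xi_{\alpha(\beta_j)_j,\rho(\rho_j)_j}\cdot\sigma_{\alpha\rho,(\beta_{\rho j}\rho_j)_j}=\sigma_{\alpha,(\beta_j)_j}\cdot(\xi_{\alpha,\rho}\ast(\xi_{\beta_{\rho j},\rho_j})_j)$, where the last factor is the horizontal composite, $\rho_j$ is a permutation of the inputs of $\beta_{\rho j}$, and $\rho(\rho_j)_j$ is the block permutation which sends the $k$-th element of the $j$-th block to the $\rho_j(k)$-th element of the $\rho j$-th block; * $\sigma_{\alpha(\beta_j)_j,(\gamma_{jk})_{jk}}\cdot\sigma_{\alpha,(\beta_j)_j}\prod_{j,k}H_{\gamma_{jk}}=\sigma_{\alpha,(\beta_j(\gamma_{jk})_k)_j}\cdot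 H_\alpha(\prod_j\sigma_{\beta_j,(\gamma_{jk})_k})$. Such a lax morphism determines a corresponding lax $T$-algebra structure $(a,\overline a_0,\overline a_2)$ on $H$: one has $a(\alpha,(y_j)_j)=H_\alpha(y_j)_j$, the map $(\rho,(\gamma_j)_j):(\alpha\rho,(x_j)_j)\to(\alpha,(y_j)_j)$ is sent by $a$ to the composite of $H_{\alpha\rho}(\gamma_j)_j$ and the component of $\xi_{\alpha,\rho}$ at $(y_j)_j$, and the components of $\overline a_0:1\to a\eta$ and $\overline a_2:a\,T(a)\to a\mu$ are those of $\nu$ and $\sigma$. For lax $T$-algebras $(H,a)$ and $(K,b)$, the structure of a lax morphism on a morphism $f:H\to K$ of $\mathbf{Cat}/I$ is a 2-cell $\overline f:b\,T(f)\to fa$ with $\overline f\eta\cdot\overline b_0f=f\overline a_0$ and $\overline f\mu\cdot\overline b_2T^2(f)=f\overline a_2\cdot\overline fT(a)\cdot bT(\overline f)$. A colax morphism has $\overline f:fa\to b\,T(f)$ instead, with the analogous axioms. A pseudo (strict) morphism is a lax morphism with $\overline f$ invertible (an identity). For lax morphisms $H,K:T\to\underline{\mathbf{Cat}}$, the structure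 of a lax-natural transformation on $f=(f_i:H_i\to K_i)_{i\in I}$ consists of a natural transformation $\overline f_\alpha:K_\alpha(\prod_jf_{i_j})\to f_iH_\alpha$ for each $\alpha:(i_j)_j\to i$, such that * $f_i\xi^H_{\alpha,\rho}\cdot\overline f_{\alpha\rho}c_\rho=\overline f_\alpha\cdot\xi^K_{\alpha,\rho}\prod_jf_{i_j}$; * $\overline f_{1_i}\cdot\nu^K_if_i=f_i\nu^H_i$; * $\overline f_{\alpha(\beta_j)_j}\cdot\sigma^K_{\alpha,(\beta_j)_j}\prod_{j,k}f_{i_{jk}}=f_i\sigma^H_{\alpha,(\beta_j)_j}\cdot\overline f_\alpha\prod_jH_{\beta_j}\cdot K_\alpha\prod_j\overline f_{\beta_j}$, for $\beta_j:(i_{jk})_k\to i_j$. A colax-natural transformation has $\overline f_\alpha:f_iH_\alpha\to K_\alpha(\prod_jf_{i_j})$ instead, with the analogous axioms. A pseudo-natural (natural) transformation is a lax-natural one in which every $\overline f_\alpha$ is invertible (an identity). **Theorem.** Let $T$ be an operad with object set $I$, let $f:H\to K$ be a morphism of $\mathbf{Cat}/I$, and suppose that $H$ and $K$ have the structure of lax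 morphisms $T\to\underline{\mathbf{Cat}}$. With respect to the corresponding lax $T$-algebra structures on $H$ and $K$, to give $f$ the structure of a lax, colax, pseudo or strict $T$-algebra morphism is to give $f$ the structure of a lax-natural, colax-natural, pseudo-natural or natural transformation, respectively. More precisely, in each of the four cases there is a bijection $\overline f\leftrightarrow(\overline f_\alpha)_\alpha$ between the two sets of structures, under which the component of $\overline f_\alpha$ at $(y_j)_j$ is the component of $\overline f$ at $(\alpha,(y_j)_j)$. -/

import Mathlib

open CategoryTheory Bicategory

universe w v u

section TwoMonads

/-- A 2-monad on a strict 2-category `K`. -/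
structure TwoMonad (K : Type u) [Bicategory.{w, v} K] [Bicategory.Strict K] extends
    StrictPseudofunctor K K where
  /-- the components of the unit -/
  η (A : K) : A ⟶ obj A
  η_naturality {A B : K} (f : A ⟶ B) : f ≫ η B = η A ≫ map f
  η_naturality₂ {A B : K} {f g : A ⟶ B} (θ : f ⟶ g) :
    θ ▷ η B = eqToHom (η_naturality f) ≫ η A ◁ map₂ θ ≫ eqToHom (η_naturality g).symm
  /-- the components of the multiplication -/
  μ (A : K) : obj (obj A) ⟶ obj A
  μ_naturality {A B : K} (f : A ⟶ B) : map (map f) ≫ μ B = μ A ≫ map f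
  μ_naturality₂ {A B : K} {f g : A ⟶ B} (θ : f ⟶ g) :
    map₂ (map₂ θ) ▷ μ B =
      eqToHom (μ_naturality f) ≫ μ A ◁ map₂ θ ≫ eqToHom (μ_naturality g).symm
  η_μ (A : K) : η (obj A) ≫ μ A = 𝟙 (obj A)
  map_η_μ (A : K) : map (η A) ≫ μ A = 𝟙 (obj A)
  μ_assoc (A : K) : μ (obj A) ≫ μ A = map (μ A) ≫ μ A

namespace TwoMonad

variable {K : Type u} [Bicategory.{w, v} K] [Bicategory.Strict K] (T : TwoMonad K)

section eqs

variable {A B : K}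

-- Equalities of 1-cells, which type the coherence axioms below. Composition is written in
-- diagrammatic order, so `f ≫ g` is the composite `g f`.

theorem eq_unit_left (a : T.obj A ⟶ A) :
    a ≫ T.η A ≫ a = T.η (T.obj A) ≫ T.map a ≫ a := by
  rw [← Strict.assoc, T.η_naturality, Strict.assoc]

theorem eq_unit_left' (a : T.obj A ⟶ A) : T.η (T.obj A) ≫ T.μ A ≫ a = a := by
  rw [← Strict.assoc, T.η_μ, Strict.id_comp]

theorem eq_unit_right (a : T.obj A ⟶ A) : a = T.map (𝟙 A) ≫ a := by
  rw [T.map_id, Strict.id_comp]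

theorem eq_map_comp {C D : K} (f : A ⟶ B) (g : B ⟶ C) (h : T.obj C ⟶ D) :
    T.map (f ≫ g) ≫ h = T.map f ≫ T.map g ≫ h := by
  rw [T.map_comp, Strict.assoc]

theorem eq_unit_right' (a : T.obj A ⟶ A) : T.map (T.η A) ≫ T.μ A ≫ a = a := by
  rw [← Strict.assoc, T.map_η_μ, Strict.id_comp]

theorem eq_μ {C : K} (f : A ⟶ B) (h : T.obj B ⟶ C) :
    T.map (T.map f) ≫ T.μ B ≫ h = T.μ A ≫ T.map f ≫ h := by
  rw [← Strict.assoc, T.μ_naturality, Strict.assoc]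

theorem eq_assoc (a : T.obj A ⟶ A) :
    T.map (T.μ A) ≫ T.μ A ≫ a = T.μ (T.obj A) ≫ T.μ A ≫ a := by
  rw [← Strict.assoc, ← T.μ_assoc, Strict.assoc]

theorem eq_η {C : K} (f : A ⟶ B) (h : T.obj B ⟶ C) :
    f ≫ T.η B ≫ h = T.η A ≫ T.map f ≫ h := by
  rw [← Strict.assoc, T.η_naturality, Strict.assoc]

end eqs

/-- A lax `T`-algebra structure on the object `A`. -/
structure LaxAlgebra (A : K) where
  /-- the action `a : T A ⟶ A` -/
  a : T.obj A ⟶ A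
  /-- the coherence 2-cell `1 ⟶ a η` -/
  a₀ : 𝟙 A ⟶ T.η A ≫ a
  /-- the coherence 2-cell `a T(a) ⟶ a μ` -/
  a₂ : T.map a ≫ a ⟶ T.μ A ≫ a
  unit_left :
    eqToHom (Strict.comp_id a).symm ≫ a ◁ a₀ ≫ eqToHom (T.eq_unit_left a) ≫
      T.η (T.obj A) ◁ a₂ ≫ eqToHom (T.eq_unit_left' a) = 𝟙 a
  unit_right :
    eqToHom (T.eq_unit_right a) ≫ T.map₂ a₀ ▷ a ≫ eqToHom (T.eq_map_comp (T.η A) a a) ≫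
      T.map (T.η A) ◁ a₂ ≫ eqToHom (T.eq_unit_right' a) = 𝟙 a
  assoc :
    T.map (T.map a) ◁ a₂ ≫ eqToHom (T.eq_μ a a) ≫ T.μ (T.obj A) ◁ a₂ =
      eqToHom (T.eq_map_comp (T.map a) a a).symm ≫ T.map₂ a₂ ▷ a ≫
        eqToHom (T.eq_map_comp (T.μ A) a a) ≫ T.map (T.μ A) ◁ a₂ ≫ eqToHom (T.eq_assoc a)

variable {T} {A B : K}

/-- The structure of a lax morphism of lax `T`-algebras on the 1-cell `f`. -/
structure LaxMorphism (𝔸 : T.LaxAlgebra A) (𝔹 : T.LaxAlgebra B) (f : A ⟶ B) where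
  /-- the coherence 2-cell `b T(f) ⟶ f a` -/
  cell : T.map f ≫ 𝔹.a ⟶ 𝔸.a ≫ f
  unit :
    eqToHom (Strict.comp_id f).symm ≫ f ◁ 𝔹.a₀ ≫ eqToHom (T.eq_η f 𝔹.a) ≫ T.η A ◁ cell =
      eqToHom (Strict.id_comp f).symm ≫ 𝔸.a₀ ▷ f ≫ eqToHom (Strict.assoc _ _ _)
  mult :
    T.map (T.map f) ◁ 𝔹.a₂ ≫ eqToHom (T.eq_μ f 𝔹.a) ≫ T.μ A ◁ cell =
      eqToHom (T.eq_map_comp (T.map f) 𝔹.a 𝔹.a).symm ≫ T.map₂ cell ▷ 𝔹.a ≫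
        eqToHom (T.eq_map_comp 𝔸.a f 𝔹.a) ≫ T.map 𝔸.a ◁ cell ≫
          eqToHom (Strict.assoc _ _ _).symm ≫ 𝔸.a₂ ▷ f ≫ eqToHom (Strict.assoc _ _ _)

/-- The structure of a colax morphism of lax `T`-algebras on the 1-cell `f`. -/
structure ColaxMorphism (𝔸 : T.LaxAlgebra A) (𝔹 : T.LaxAlgebra B) (f : A ⟶ B) where
  /-- the coherence 2-cell `f a ⟶ b T(f)` -/
  cell : 𝔸.a ≫ f ⟶ T.map f ≫ 𝔹.a
  unit :
    eqToHom (Strict.id_comp f).symm ≫ 𝔸.a₀ ▷ f ≫ eqToHom (Strict.assoc _ _ _) ≫ T.η A ◁ cell =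
      eqToHom (Strict.comp_id f).symm ≫ f ◁ 𝔹.a₀ ≫ eqToHom (T.eq_η f 𝔹.a)
  mult :
    eqToHom (Strict.assoc _ _ _).symm ≫ 𝔸.a₂ ▷ f ≫ eqToHom (Strict.assoc _ _ _) ≫
        T.μ A ◁ cell =
      T.map 𝔸.a ◁ cell ≫ eqToHom (T.eq_map_comp 𝔸.a f 𝔹.a).symm ≫ T.map₂ cell ▷ 𝔹.a ≫
        eqToHom (T.eq_map_comp (T.map f) 𝔹.a 𝔹.a) ≫ T.map (T.map f) ◁ 𝔹.a₂ ≫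
          eqToHom (T.eq_μ f 𝔹.a)

/-- The structure of a pseudo morphism: a lax morphism whose coherence 2-cell is invertible. -/
structure PseudoMorphism (𝔸 : T.LaxAlgebra A) (𝔹 : T.LaxAlgebra B) (f : A ⟶ B) extends
    LaxMorphism 𝔸 𝔹 f where
  isIso_cell : IsIso cell

/-- The structure of a strict morphism: a lax morphism whose coherence 2-cell is an identity. -/
structure StrictMorphism (𝔸 : T.LaxAlgebra A) (𝔹 : T.LaxAlgebra B) (f : A ⟶ B) extends
    LaxMorphism 𝔸 𝔹 f where
  comm : T.map f ≫ 𝔹.a = 𝔸.a ≫ f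
  cell_eq : cell = eqToHom comm

end TwoMonad

end TwoMonads

/-- The 2-category `Cat/I` for a set `I`, whose objects are seen as `I`-indexed families of small
categories. Its 1-cells are families of functors, its 2-cells families of natural
transformations. -/
structure FamCat (I : Type u) where
  /-- the fibre over `i`, written `X i` -/
  fib (i : I) : Cat.{u, u}

namespace FamCat

variable {I : Type u}

instance : CoeFun (FamCat I) fun _ => I → Cat.{u, u} := ⟨fib⟩

instance : CategoryStruct (FamCat I) where
  Hom X Y := ∀ i, X i ⥤ Y i
  id X i := 𝟭 (X i)
  comp F G i := F i ⋙ G i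

instance homCat (X Y : FamCat I) : Category (X ⟶ Y) where
  Hom F G := ∀ i, F i ⟶ G i
  id F i := 𝟙 (F i)
  comp θ φ i := θ i ≫ φ i

/-- The isomorphism of 1-cells with given components. -/
def isoMk {X Y : FamCat I} {F G : X ⟶ Y} (e : ∀ i, F i ≅ G i) : F ≅ G where
  hom i := (e i).hom
  inv i := (e i).inv
  hom_inv_id := funext fun i => (e i).hom_inv_id
  inv_hom_id := funext fun i => (e i).inv_hom_id

instance : Bicategory (FamCat I) where
  homCategory := homCat
  whiskerLeft F _ _ (θ : ∀ i, _) i := Functor.whiskerLeft (F i) (θ i)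
  whiskerRight (θ : ∀ i, _) G i := Functor.whiskerRight (θ i) (G i)
  associator F G H := isoMk fun i => Functor.associator (F i) (G i) (H i)
  leftUnitor F := isoMk fun i => Functor.leftUnitor (F i)
  rightUnitor F := isoMk fun i => Functor.rightUnitor (F i)
  whiskerLeft_id _ _ := rfl
  whiskerLeft_comp _ _ _ _ _ _ := rfl
  id_whiskerLeft θ := funext fun i => NatTrans.ext <| funext fun _ =>
    ((Category.id_comp _).trans (Category.comp_id _)).symm
  comp_whiskerLeft _ _ _ _ _ := funext fun i => NatTrans.ext <| funext fun _ =>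
    ((Category.id_comp _).trans (Category.comp_id _)).symm
  id_whiskerRight _ G := funext fun i => NatTrans.ext <| funext fun _ => (G i).map_id _
  comp_whiskerRight _ _ G := funext fun i => NatTrans.ext <| funext fun _ => (G i).map_comp _ _
  whiskerRight_id _ := funext fun i => NatTrans.ext <| funext fun _ =>
    ((Category.id_comp _).trans (Category.comp_id _)).symm
  whiskerRight_comp _ _ _ := funext fun i => NatTrans.ext <| funext fun _ =>
    ((Category.id_comp _).trans (Category.comp_id _)).symm
  whisker_assoc _ _ _ _ _ := funext fun i => NatTrans.ext <| funext fun _ =>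
    ((Category.id_comp _).trans (Category.comp_id _)).symm
  whisker_exchange θ φ := funext fun i => NatTrans.ext <| funext fun x => ((φ i).naturality ((θ i).app x)).symm
  pentagon F G H L := funext fun i => NatTrans.ext <| funext fun x => by
    change (L i).map (𝟙 _) ≫ 𝟙 _ ≫ 𝟙 _ = 𝟙 _ ≫ 𝟙 _
    simp
  triangle F G := funext fun i => NatTrans.ext <| funext fun x => by
    change 𝟙 _ ≫ 𝟙 _ = (G i).map (𝟙 _)
    simp

instance : Bicategory.Strict (FamCat I) where
  id_comp _ := rfl
  comp_id _ := rfl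
  assoc _ _ _ := rfl
  leftUnitor_eqToIso _ := Iso.ext rfl
  rightUnitor_eqToIso _ := Iso.ext rfl
  associator_eqToIso _ _ _ := Iso.ext rfl

@[ext] theorem hom₂_ext {X Y : FamCat I} {F G : X ⟶ Y} {θ φ : F ⟶ G}
    (h : ∀ i x, (θ i).app x = (φ i).app x) : θ = φ :=
  funext fun i => NatTrans.ext (funext (h i))

@[simp] theorem comp_app {X Y : FamCat I} {F G H : X ⟶ Y} (θ : F ⟶ G) (φ : G ⟶ H) (i : I)
    (x : X i) : ((θ ≫ φ) i).app x = (θ i).app x ≫ (φ i).app x := rfl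

@[simp] theorem id_app {X Y : FamCat I} (F : X ⟶ Y) (i : I) (x : X i) :
    ((𝟙 F : F ⟶ F) i).app x = 𝟙 ((F i).obj x) := rfl

@[simp] theorem eqToHom_app {X Y : FamCat I} {F G : X ⟶ Y} (h : F = G) (i : I) (x : X i) :
    ((eqToHom h : F ⟶ G) i).app x = eqToHom (by rw [h]) := by
  subst h; rfl

theorem heq_app {X Y : FamCat I} {F F' G G' : X ⟶ Y} (h : F = F') (θ : F' ⟶ G') (h' : G' = G)
    (i : I) (x : X i) : HEq (((eqToHom h ≫ θ ≫ eqToHom h') i).app x) ((θ i).app x) := by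
  subst h h'
  rw [eqToHom_refl, eqToHom_refl, Category.id_comp, Category.comp_id]

@[simp] theorem whiskerLeft_app {X Y Z : FamCat I} (F : X ⟶ Y) {G H : Y ⟶ Z} (θ : G ⟶ H) (i : I)
    (x : X i) : ((F ◁ θ) i).app x = (θ i).app ((F i).obj x) := rfl

@[simp] theorem whiskerRight_app {X Y Z : FamCat I} {F G : X ⟶ Y} (θ : F ⟶ G) (H : Y ⟶ Z) (i : I)
    (x : X i) : ((θ ▷ H) i).app x = (H i).map ((θ i).app x) := rfl

end FamCat


/-- A collection with object set `I`. A bijection `Fin m ≃ Fin n` exists only for `m = n`, so `act`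
is exactly the action of the permutations of the inputs; `act α ρ` is `αρ`, whose `j`-th input is
the `ρ j`-th input of `α`. -/
structure Collection (I : Type u) where
  /-- the arrows with source the sequence `c` and target `i` -/
  Hom {n : ℕ} (c : Fin n → I) (i : I) : Type u
  act {m n : ℕ} {c : Fin n → I} {i : I} (α : Hom c i) (ρ : Fin m ≃ Fin n) :
    Hom (fun j => c (ρ j)) i
  act_one {n : ℕ} {c : Fin n → I} {i : I} (α : Hom c i) : act α (Equiv.refl (Fin n)) = α
  act_mul {l m n : ℕ} {c : Fin n → I} {i : I} (α : Hom c i) (ρ : Fin m ≃ Fin n)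
    (τ : Fin l ≃ Fin m) : act (act α ρ) τ = act α (τ.trans ρ)

/-- An arrow of a collection with target `i`, with its source as part of the data. -/
structure Collection.Arrow {I : Type u} (T : Collection I) (i : I) where
  {arity : ℕ}
  {src : Fin arity → I}
  hom : T.Hom src i

theorem Collection.arrow_act_act {I : Type u} (T : Collection I) {i : I} {l m n : ℕ}
    {c : Fin n → I} {α : T.Hom c i} {s : Fin m → I} {β : T.Hom s i} {τ : Fin m ≃ Fin n}
    (h : (⟨β⟩ : T.Arrow i) = ⟨T.act α τ⟩) (ρ : Fin l ≃ Fin m) :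
    (⟨T.act β ρ⟩ : T.Arrow i) = ⟨T.act α (ρ.trans τ)⟩ := by
  rw [Arrow.mk.injEq] at h
  obtain ⟨-, hs, hb⟩ := h
  obtain rfl := eq_of_heq hs
  obtain rfl := eq_of_heq hb
  exact congrArg (Arrow.mk (src := fun j => c (τ (ρ j)))) (T.act_mul α τ ρ)

/-- The concatenation `(a₁₁, …, a₁ₘ₁, …, aₙ₁, …, aₙₘₙ)` of `n` finite sequences. -/
def concat {n : ℕ} {m : Fin n → ℕ} {S : (j : Fin n) → Fin (m j) → Type*}
    (a : ∀ j k, S j k) (p : Fin (∑ j, m j)) :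
    S (finSigmaFinEquiv.symm p).1 (finSigmaFinEquiv.symm p).2 :=
  a (finSigmaFinEquiv.symm p).1 (finSigmaFinEquiv.symm p).2

/-- The permutation `ρ(τ_j)_j` which permutes blocks by `ρ`, and the elements within the blocks by
the `τ j`: the `k`-th element of the `j`-th block is sent to the `τ j k`-th element of the `ρ j`-th
block. -/
def blockPerm {n' n : ℕ} {m' : Fin n' → ℕ} {m : Fin n → ℕ} (ρ : Fin n' ≃ Fin n)
    (τ : ∀ j, Fin (m' j) ≃ Fin (m (ρ j))) : Fin (∑ j, m' j) ≃ Fin (∑ j, m j) :=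
  (finSigmaFinEquiv.symm.trans (Equiv.sigmaCongr ρ τ)).trans finSigmaFinEquiv

/-- An operad (symmetric multicategory) with object set `I`. The axioms are equations between
arrows with their sources, as the two sides have equal sources only up to a calculation with finite
sequences. -/
structure SymOperad (I : Type u) extends Collection I where
  one (i : I) : Hom (fun _ : Fin 1 => i) i
  comp {n : ℕ} {c : Fin n → I} {i : I} (α : Hom c i) {m : Fin n → ℕ}
    {d : (j : Fin n) → Fin (m j) → I} (β : ∀ j, Hom (d j) (c j)) : Hom (concat d) i
  one_comp {n : ℕ} {c : Fin n → I} {i : I} (α : Hom c i) :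
    (⟨comp (one i) fun _ => α⟩ : toCollection.Arrow i) = ⟨α⟩
  comp_one {n : ℕ} {c : Fin n → I} {i : I} (α : Hom c i) :
    (⟨comp α fun j => one (c j)⟩ : toCollection.Arrow i) = ⟨α⟩
  assoc {n : ℕ} {c : Fin n → I} {i : I} (α : Hom c i) {m : Fin n → ℕ}
    {d : (j : Fin n) → Fin (m j) → I} (β : ∀ j, Hom (d j) (c j))
    {l : (j : Fin n) → Fin (m j) → ℕ} {e : (j : Fin n) → (k : Fin (m j)) → Fin (l j k) → I}
    (γ : ∀ j k, Hom (e j k) (d j k)) :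
    (⟨comp α fun j => comp (β j) (γ j)⟩ : toCollection.Arrow i) = ⟨comp (comp α β) (concat γ)⟩
  equivariance {n' n : ℕ} {c : Fin n → I} {i : I} (α : Hom c i) {m : Fin n → ℕ}
    {d : (j : Fin n) → Fin (m j) → I} (β : ∀ j, Hom (d j) (c j)) (ρ : Fin n' ≃ Fin n)
    {m' : Fin n' → ℕ} (τ : ∀ j, Fin (m' j) ≃ Fin (m (ρ j))) :
    (⟨comp (act α ρ) fun j => act (β (ρ j)) (τ j)⟩ : toCollection.Arrow i) =
      ⟨act (comp α β) (blockPerm ρ τ)⟩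


theorem SymOperad.comp_congr {I : Type u} (T : SymOperad I) {i : I} {n : ℕ} {c c' : Fin n → I}
    {α : T.Hom c i} {α' : T.Hom c' i} (h : (⟨α⟩ : T.Arrow i) = ⟨α'⟩) {m m' : Fin n → ℕ}
    {d : (j : Fin n) → Fin (m j) → I} {d' : (j : Fin n) → Fin (m' j) → I}
    {β : ∀ j, T.Hom (d j) (c j)} {β' : ∀ j, T.Hom (d' j) (c' j)}
    (h' : ∀ j, (⟨c j, ⟨β j⟩⟩ : Σ i, T.Arrow i) = ⟨c' j, ⟨β' j⟩⟩) :
    (⟨T.comp α β⟩ : T.Arrow i) = ⟨T.comp α' β'⟩ := by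
  rw [Collection.Arrow.mk.injEq] at h
  obtain ⟨-, hs, hb⟩ := h
  obtain rfl := eq_of_heq hs
  obtain rfl := eq_of_heq hb
  have h'' : (fun j => (⟨β j⟩ : T.Arrow (c j))) = fun j => ⟨β' j⟩ :=
    funext fun j => eq_of_heq (Sigma.mk.inj (h' j)).2
  exact congrArg (fun B : (j : Fin n) → T.Arrow (c j) =>
    (⟨T.comp α fun j => (B j).hom⟩ : T.Arrow i)) h''

/-- An operation of `T` labelled in the family of categories `X`, with target `i`. -/
structure LabOp {I : Type u} (T : Collection I) (X : FamCat I) (i : I) where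
  {arity : ℕ}
  {src : Fin arity → I}
  op : T.Hom src i
  lab (j : Fin arity) : X (src j)

namespace LabOp

variable {I : Type u} {T : Collection I} {X Y Z : FamCat I} {i : I}

/-- The label `x_j`, as an object of the total category of the family `X`. -/
abbrev tot (a : LabOp T X i) (j : Fin a.arity) : Σ i, X i := ⟨a.src j, a.lab j⟩

/-- A morphism `(α, (x_j)_j) ⟶ (β, (y_j)_j)` of labelled operations: a permutation `ρ` such that
`α = βρ`, with morphisms `γ_j : x_j ⟶ y_{ρ j}`. -/
structure Hom (a b : LabOp T X i) where
  perm : Fin a.arity ≃ Fin b.arity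
  op_eq : (⟨a.op⟩ : T.Arrow i) = ⟨T.act b.op perm⟩
  lab (j : Fin a.arity) : a.tot j ⟶ b.tot (perm j)

theorem Hom.ext {a b : LabOp T X i} : ∀ {f g : Hom a b}, f.perm = g.perm → HEq f.lab g.lab → f = g
  | ⟨_, _, _⟩, ⟨_, _, _⟩, rfl, HEq.refl _ => rfl

theorem arrow_act {a b c : LabOp T X i} {ρ : Fin a.arity ≃ Fin b.arity}
    {τ : Fin b.arity ≃ Fin c.arity} (h : (⟨a.op⟩ : T.Arrow i) = ⟨T.act b.op ρ⟩)
    (h' : (⟨b.op⟩ : T.Arrow i) = ⟨T.act c.op τ⟩) :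
    (⟨a.op⟩ : T.Arrow i) = ⟨T.act c.op (ρ.trans τ)⟩ :=
  h.trans (T.arrow_act_act h' ρ)

theorem arrow_one (a : LabOp T X i) :
    (⟨a.op⟩ : T.Arrow i) = ⟨T.act a.op (Equiv.refl (Fin a.arity))⟩ :=
  congrArg (Collection.Arrow.mk (src := a.src)) (T.act_one a.op).symm

instance : Quiver (LabOp T X i) := ⟨Hom⟩

instance : Category (LabOp T X i) where
  id a := ⟨Equiv.refl _, arrow_one a, fun _ => 𝟙 _⟩
  comp f g := ⟨f.perm.trans g.perm, arrow_act f.op_eq g.op_eq,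
    fun j => f.lab j ≫ g.lab (f.perm j)⟩
  id_comp _ := Hom.ext rfl (heq_of_eq (funext fun _ => Category.id_comp _))
  comp_id _ := Hom.ext rfl (heq_of_eq (funext fun _ => Category.comp_id _))
  assoc _ _ _ := Hom.ext rfl (heq_of_eq (funext fun _ => Category.assoc _ _ _))

@[simp] theorem id_perm (a : LabOp T X i) : (𝟙 a : a ⟶ a).perm = Equiv.refl _ := rfl
@[simp] theorem id_lab (a : LabOp T X i) (j) : (𝟙 a : a ⟶ a).lab j = 𝟙 _ := rfl
@[simp] theorem comp_perm {a b c : LabOp T X i} (f : a ⟶ b) (g : b ⟶ c) :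
    (f ≫ g).perm = f.perm.trans g.perm := rfl
@[simp] theorem comp_lab {a b c : LabOp T X i} (f : a ⟶ b) (g : b ⟶ c) (j) :
    (f ≫ g).lab j = f.lab j ≫ g.lab (f.perm j) := rfl

theorem ext_tot {a b : LabOp T X i} (h : (⟨a.op⟩ : T.Arrow i) = ⟨b.op⟩)
    (h' : ∀ (j : Fin a.arity) (k : Fin b.arity), j.val = k.val → a.tot j = b.tot k) : a = b := by
  obtain ⟨aop, alab⟩ := a
  obtain ⟨bop, blab⟩ := b
  cases h
  congr 1
  funext j
  exact eq_of_heq (Sigma.mk.inj (h' j j rfl)).2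

theorem hom_hext {a b a' b' : LabOp T X i} (ha : a = a') (hb : b = b') (f : a ⟶ b) (g : a' ⟶ b')
    (h : ∀ (j : Fin a.arity) (j' : Fin a'.arity), j.val = j'.val →
      (f.perm j).val = (g.perm j').val ∧ HEq (f.lab j) (g.lab j')) : HEq f g := by
  subst ha hb
  apply heq_of_eq
  obtain ⟨fp, fo, fl⟩ := f
  obtain ⟨gp, go, gl⟩ := g
  obtain rfl : fp = gp := Equiv.ext fun j => Fin.ext (h j j rfl).1
  congr 1
  funext j
  exact eq_of_heq (h j j rfl).2

theorem hom_hext' {a b : LabOp T X i} (f g : a ⟶ b)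
    (h : ∀ j, (f.perm j).val = (g.perm j).val ∧ HEq (f.lab j) (g.lab j)) : f = g :=
  eq_of_heq (hom_hext rfl rfl f g fun j j' e => by obtain rfl := Fin.ext e; exact h j)

theorem sigma_map_id {p q : Σ i, X i} (g : p ⟶ q) :
    (Sigma.Functor.sigma (𝟙 X : ∀ i, X i ⥤ X i)).map g = g := by
  obtain ⟨g⟩ := g; rfl

theorem sigma_map_comp (F : X ⟶ Y) (G : Y ⟶ Z) {p q : Σ i, X i} (g : p ⟶ q) :
    (Sigma.Functor.sigma (F ≫ G : ∀ i, X i ⥤ Z i)).map g =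
      (Sigma.Functor.sigma G).map ((Sigma.Functor.sigma F).map g) := by
  obtain ⟨g⟩ := g; rfl

/-- The functor `T X → T Y` induced by `F : X → Y`. -/
def map (F : X ⟶ Y) (i : I) : LabOp T X i ⥤ LabOp T Y i where
  obj a := ⟨a.op, fun j => (F (a.src j)).obj (a.lab j)⟩
  map f := ⟨f.perm, f.op_eq, fun j => (Sigma.Functor.sigma F).map (f.lab j)⟩
  map_id a := Hom.ext rfl (heq_of_eq (funext fun j => (Sigma.Functor.sigma F).map_id (a.tot j)))
  map_comp f g :=
    Hom.ext rfl (heq_of_eq (funext fun j =>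
      (Sigma.Functor.sigma F).map_comp (f.lab j) (g.lab (f.perm j))))

/-- The natural transformation `T F ⟶ T G` induced by `θ : F ⟶ G`. -/
def map₂ {F G : X ⟶ Y} (θ : F ⟶ G) (i : I) : map (T := T) F i ⟶ map G i where
  app a := ⟨Equiv.refl (Fin a.arity), arrow_one _, fun j : Fin a.arity =>
    Sigma.SigmaHom.mk ((θ (a.src j)).app (a.lab j))⟩
  naturality _ _ f :=
    Hom.ext rfl (heq_of_eq (funext fun j => (Sigma.natTrans.sigma θ).naturality (f.lab j)))

theorem hom_ext {a b : LabOp T X i} (f g : a ⟶ b) (hp : f.perm = g.perm)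
    (hl : ∀ j, HEq (f.lab j) (g.lab j)) : f = g :=
  hom_hext' f g fun j => ⟨by rw [hp], hl j⟩

theorem map_id_eq (X : FamCat I) (i : I) : map (T := T) (𝟙 X) i = 𝟭 (LabOp T X i) :=
  CategoryTheory.Functor.hext (fun _ => rfl) fun _ _ f =>
    heq_of_eq (hom_ext _ _ rfl fun j => heq_of_eq (sigma_map_id (f.lab j)))

theorem map_comp_eq (F : X ⟶ Y) (G : Y ⟶ Z) (i : I) :
    map (T := T) (F ≫ G) i = map F i ⋙ map G i :=
  CategoryTheory.Functor.hext (fun _ => rfl) fun _ _ f =>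
    heq_of_eq (hom_ext _ _ rfl fun j => heq_of_eq (sigma_map_comp F G (f.lab j)))

/-- `T X`, as an object of `Cat/I`. -/
def fam (T : Collection I) (X : FamCat I) : FamCat I := ⟨fun i => Cat.of (LabOp T X i)⟩

/-- `T F`, as a 1-cell of `Cat/I`. -/
def famMap (T : Collection I) (F : X ⟶ Y) : fam T X ⟶ fam T Y := map F

/-- `T θ`, as a 2-cell of `Cat/I`. -/
def famMap₂ (T : Collection I) {F G : X ⟶ Y} (θ : F ⟶ G) : famMap T F ⟶ famMap T G := map₂ θ

/-- The endo-2-functor of `Cat/I` given by labelled operations. -/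
def twoFunctor (T : Collection I) : StrictPseudofunctor (FamCat I) (FamCat I) :=
  StrictPseudofunctor.mk''
    { obj := fam T
      map := famMap T
      map₂ := famMap₂ T
      map₂_id _ := FamCat.hom₂_ext fun _ _ => rfl
      map₂_comp _ _ := FamCat.hom₂_ext fun _ _ => rfl
      map_id X := funext fun i => map_id_eq X i
      map_comp F G := funext fun i => map_comp_eq F G i
      map₂_whisker_left F _ _ θ := FamCat.hom₂_ext fun i a =>
        eq_of_heq (FamCat.heq_app _ (famMap T F ◁ famMap₂ T θ) _ i a).symm
      map₂_whisker_right θ F := FamCat.hom₂_ext fun i a =>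
        eq_of_heq (FamCat.heq_app _ (famMap₂ T θ ▷ famMap T F) _ i a).symm }

end LabOp

section Combinatorics

variable {n : ℕ} {m : Fin n → ℕ}

theorem finSigma_lt (s t : (j : Fin n) × Fin (m j))
    (h : Sigma.Lex (· < ·) (fun _ => (· < ·)) s t) :
    finSigmaFinEquiv s < finSigmaFinEquiv t := by
  rw [Fin.lt_def, finSigmaFinEquiv_apply, finSigmaFinEquiv_apply]
  cases h with
  | right a b h => exact Nat.add_lt_add_left h _
  | left a b h =>
    rename_i i j
    have key : ∀ (x : ℕ) (hx : x ≤ n), (∑ y : Fin x, m (Fin.castLE hx y)) =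
        ∑ y ∈ Finset.univ.filter (fun y : Fin n => y.val < x), m y := by
      intro x hx
      refine Finset.sum_bij (fun y _ => Fin.castLE hx y) ?_ ?_ ?_ ?_
      · intro y _; simp
      · intro y _ z _ hyz; simpa using hyz
      · intro y hy; exact ⟨⟨y.val, by simpa using hy⟩, by simp, rfl⟩
      · intro y _; rfl
    simp only
    rw [key _ i.2.le, key _ j.2.le]
    have hsub : insert i (Finset.univ.filter (fun y : Fin n => y.val < i.val)) ⊆
        Finset.univ.filter (fun y : Fin n => y.val < j.val) := by
      intro y hy
      simp only [Finset.mem_insert, Finset.mem_filter, Finset.mem_univ, true_and] at hy ⊢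
      have := Fin.lt_def.1 h
      rcases hy with rfl | hy <;> omega
    have := Finset.sum_le_sum_of_subset (f := m) hsub
    rw [Finset.sum_insert (by simp)] at this
    have := a.2
    omega

theorem finSigma_symm_lt {p q : Fin (∑ j, m j)} (h : p < q) :
    Sigma.Lex (· < ·) (fun _ => (· < ·)) (finSigmaFinEquiv.symm p) (finSigmaFinEquiv.symm q) := by
  rcases trichotomous_of (Sigma.Lex (· < ·) (fun _ => (· < ·)))
    (finSigmaFinEquiv.symm p) (finSigmaFinEquiv.symm q) with h' | h' | h'
  · exact h'
  · exact absurd (finSigmaFinEquiv.symm.injective h') h.ne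
  · have := finSigma_lt _ _ h'
    rw [Equiv.apply_symm_apply, Equiv.apply_symm_apply] at this
    exact absurd h this.asymm

theorem finSigma_symm_one {m : Fin 1 → ℕ} (p : Fin (∑ j, m j)) :
    ((finSigmaFinEquiv.symm p).2 : ℕ) = p := by
  conv_rhs => rw [← finSigmaFinEquiv.apply_symm_apply p, finSigmaFinEquiv_one]

theorem finSigma_symm_ones (p : Fin (∑ _ : Fin n, 1)) :
    ((finSigmaFinEquiv.symm p).1 : ℕ) = p := by
  conv_rhs => rw [← finSigmaFinEquiv.apply_symm_apply p, finSigmaFinEquiv_apply]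
  simp

variable {l : (j : Fin n) → Fin (m j) → ℕ}

/-- The position of an element of a sequence of sequences of sequences, read off from its position
in the concatenation, concatenating the inner sequences first. -/
def pathInner (p : Fin (∑ j, ∑ k, l j k)) : (j : Fin n) × (k : Fin (m j)) × Fin (l j k) :=
  ⟨(finSigmaFinEquiv.symm p).1, finSigmaFinEquiv.symm (finSigmaFinEquiv.symm p).2⟩

/-- The position of an element of a sequence of sequences of sequences, read off from its position
in the concatenation, concatenating the outer sequences first. -/
def pathOuter (p : Fin (∑ q, concat l q)) : (j : Fin n) × (k : Fin (m j)) × Fin (l j k) :=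
  ⟨(finSigmaFinEquiv.symm (finSigmaFinEquiv.symm p).1).1,
    (finSigmaFinEquiv.symm (finSigmaFinEquiv.symm p).1).2, (finSigmaFinEquiv.symm p).2⟩

/-- The lexicographic order of positions. -/
abbrev PathLt : (j : Fin n) × (k : Fin (m j)) × Fin (l j k) →
    (j : Fin n) × (k : Fin (m j)) × Fin (l j k) → Prop :=
  Sigma.Lex (· < ·) fun _ => Sigma.Lex (· < ·) fun _ => (· < ·)

theorem pathLt_irrefl (s : (j : Fin n) × (k : Fin (m j)) × Fin (l j k)) : ¬ PathLt s s :=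
  irrefl_of PathLt s

theorem pathLt_asymm {s t : (j : Fin n) × (k : Fin (m j)) × Fin (l j k)} (h : PathLt s t) :
    ¬ PathLt t s :=
  fun h' => irrefl_of PathLt s (trans_of PathLt h h')

theorem pathInner_lt {p q : Fin (∑ j, ∑ k, l j k)} (h : p < q) :
    PathLt (pathInner p) (pathInner q) := by
  have h₁ := finSigma_symm_lt h
  unfold pathInner
  generalize finSigmaFinEquiv.symm p = s at h₁
  generalize finSigmaFinEquiv.symm q = t at h₁
  cases h₁ with
  | left a b h => exact .left _ _ h
  | right a b h => exact .right _ _ (finSigma_symm_lt h)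

theorem pathOuter_lt {p q : Fin (∑ q, concat l q)} (h : p < q) :
    PathLt (pathOuter p) (pathOuter q) := by
  have h₁ := finSigma_symm_lt h
  unfold pathOuter
  generalize finSigmaFinEquiv.symm p = s at h₁
  generalize finSigmaFinEquiv.symm q = t at h₁
  cases h₁ with
  | right a b h => exact .right _ _ (.right _ _ h)
  | @left i j a b h =>
    have h₂ := finSigma_symm_lt h
    revert a b
    unfold concat
    dsimp only
    generalize finSigmaFinEquiv.symm i = s at h₂
    generalize finSigmaFinEquiv.symm j = t at h₂
    intro a b
    cases h₂ with
    | left _ _ h => exact .left _ _ h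
    | right _ _ h => exact .right _ _ (.left _ _ h)

theorem sum_concat : ∑ q, concat l q = ∑ j, ∑ k, l j k := by
  rw [← Fintype.sum_sigma' (fun j k => l j k)]
  exact Equiv.sum_comp finSigmaFinEquiv.symm fun s : (j : Fin n) × Fin (m j) => l s.1 s.2

theorem path_eq (p : Fin (∑ j, ∑ k, l j k)) (q : Fin (∑ q, concat l q)) (h : p.val = q.val) :
    pathInner p = pathOuter q := by
  have hcard : Fintype.card ((j : Fin n) × (k : Fin (m j)) × Fin (l j k)) =
      ∑ j, ∑ k, l j k := by simp
  have inj₁ : Function.Injective (pathInner (l := l)) := fun x y hxy => by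
    rcases lt_trichotomy x y with h | h | h
    · exact absurd (hxy ▸ pathInner_lt h) (pathLt_irrefl _)
    · exact h
    · exact absurd (hxy ▸ pathInner_lt h) (pathLt_irrefl _)
  have inj₂ : Function.Injective (pathOuter (l := l)) := fun x y hxy => by
    rcases lt_trichotomy x y with h | h | h
    · exact absurd (hxy ▸ pathOuter_lt h) (pathLt_irrefl _)
    · exact h
    · exact absurd (hxy ▸ pathOuter_lt h) (pathLt_irrefl _)
  let f₁ := Equiv.ofBijective _
    ((Fintype.bijective_iff_injective_and_card _).2 ⟨inj₁, by rw [hcard, Fintype.card_fin]⟩)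
  let f₂ := Equiv.ofBijective _
    ((Fintype.bijective_iff_injective_and_card _).2
      ⟨inj₂, by rw [hcard, Fintype.card_fin, sum_concat]⟩)
  have hg : StrictMono (f₁.trans f₂.symm) := fun x y hxy => by
    have h₁ : PathLt (f₁ x) (f₁ y) := pathInner_lt hxy
    rcases lt_trichotomy (f₂.symm (f₁ x)) (f₂.symm (f₁ y)) with h | h | h
    · exact h
    · exact absurd (f₁.injective (f₂.symm.injective h)) hxy.ne
    · have h₂ : PathLt (f₂ _) (f₂ _) := pathOuter_lt h
      rw [Equiv.apply_symm_apply, Equiv.apply_symm_apply] at h₂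
      exact absurd h₂ (pathLt_asymm h₁)
  have h₃ := Fin.coe_orderIso_apply
    (hg.orderIsoOfSurjective _ (f₁.trans f₂.symm).surjective) p
  have h₄ : f₂.symm (f₁ p) = q := Fin.ext (h₃.trans h)
  rw [Equiv.symm_apply_eq] at h₄
  exact h₄

theorem val_eq_of_path_eq {p : Fin (∑ j, ∑ k, l j k)} {q : Fin (∑ q, concat l q)}
    (h : pathInner p = pathOuter q) : p.val = q.val := by
  have hq : q.val < ∑ j, ∑ k, l j k := q.2.trans_eq sum_concat
  rcases lt_trichotomy p ⟨q.val, hq⟩ with h' | h' | h'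
  · have := pathInner_lt h'
    rw [path_eq ⟨q.val, hq⟩ q rfl, h] at this
    exact absurd this (pathLt_irrefl _)
  · rw [h']
  · have := pathInner_lt h'
    rw [path_eq ⟨q.val, hq⟩ q rfl, h] at this
    exact absurd this (pathLt_irrefl _)

end Combinatorics

namespace LabOp

variable {I : Type u} {T : SymOperad I} {X Y Z : FamCat I} {i : I}

/-- `η : X → T X`, given by `x ↦ (1_i, (x))`. -/
def unit (T : SymOperad I) (X : FamCat I) (i : I) : X i ⥤ LabOp T.toCollection X i where
  obj x := ⟨T.one i, fun _ => x⟩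
  map g := ⟨Equiv.refl (Fin 1), arrow_one ⟨T.one i, fun _ => _⟩, fun _ => Sigma.SigmaHom.mk g⟩

section total

variable {p q r : Σ i, LabOp T.toCollection X i}

/-- The permutation underlying a morphism of the total category of the family `T X`. -/
def totPerm : ∀ {p q : Σ i, LabOp T.toCollection X i}, (p ⟶ q) → (Fin p.2.arity ≃ Fin q.2.arity)
  | _, _, .mk f => f.perm

/-- The labels of a morphism of the total category of the family `T X`. -/
def totLab : ∀ {p q : Σ i, LabOp T.toCollection X i} (f : p ⟶ q) (k : Fin p.2.arity),
    p.2.tot k ⟶ q.2.tot (totPerm f k)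
  | _, _, .mk f, k => f.lab k

theorem tot_op_eq (f : p ⟶ q) :
    (⟨p.1, ⟨p.2.op⟩⟩ : Σ i, T.Arrow i) = ⟨q.1, ⟨T.act q.2.op (totPerm f)⟩⟩ := by
  obtain ⟨f⟩ := f
  exact congrArg (Sigma.mk _) f.op_eq

theorem totPerm_id : totPerm (𝟙 p) = Equiv.refl _ := rfl
theorem totLab_id (k) : totLab (𝟙 p) k = 𝟙 _ := rfl

theorem totPerm_comp (f : p ⟶ q) (g : q ⟶ r) :
    totPerm (f ≫ g) = (totPerm f).trans (totPerm g) := by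
  obtain ⟨f⟩ := f; obtain ⟨g⟩ := g; rfl

theorem totLab_comp (f : p ⟶ q) (g : q ⟶ r) (k) :
    HEq (totLab (f ≫ g) k) (totLab f k ≫ totLab g (totPerm f k)) := by
  obtain ⟨f⟩ := f; obtain ⟨g⟩ := g; rfl

end total

/-- The object part of `μ : T² X → T X`: `(α, (α_j, (x_jk)_k)_j) ↦ (α(α_j)_j, (x_jk)_jk)`. -/
def join (z : LabOp T.toCollection (fam T.toCollection X) i) : LabOp T.toCollection X i :=
  ⟨T.comp z.op fun j => (z.lab j).op, concat fun j => (z.lab j).lab⟩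

/-- The label of `z` at the position `s`. -/
abbrev tot₂ (z : LabOp T.toCollection (fam T.toCollection X) i)
    (s : (j : Fin z.arity) × Fin (z.lab j).arity) : Σ i, X i := (z.lab s.1).tot s.2

/-- The position to which `f` moves the position `s`. -/
def posMap {z w : LabOp T.toCollection (fam T.toCollection X) i} (f : z ⟶ w)
    (s : (j : Fin z.arity) × Fin (z.lab j).arity) : (j : Fin w.arity) × Fin (w.lab j).arity :=
  ⟨f.perm s.1, totPerm (f.lab s.1) s.2⟩

/-- The label of `f` at the position `s`. -/
def posLab {z w : LabOp T.toCollection (fam T.toCollection X) i} (f : z ⟶ w)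
    (s : (j : Fin z.arity) × Fin (z.lab j).arity) : tot₂ z s ⟶ tot₂ w (posMap f s) :=
  totLab (f.lab s.1) s.2

theorem posMap_comp {z w v : LabOp T.toCollection (fam T.toCollection X) i} (f : z ⟶ w)
    (g : w ⟶ v) (s) : posMap (f ≫ g) s = posMap g (posMap f s) :=
  Sigma.ext rfl (heq_of_eq (DFunLike.congr_fun (totPerm_comp (f.lab s.1) (g.lab (f.perm s.1))) s.2))

theorem posLab_comp {z w v : LabOp T.toCollection (fam T.toCollection X) i} (f : z ⟶ w)
    (g : w ⟶ v) (s) : HEq (posLab (f ≫ g) s) (posLab f s ≫ posLab g (posMap f s)) :=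
  totLab_comp (f.lab s.1) (g.lab (f.perm s.1)) s.2

/-- The permutation of `join z` underlying the image of `f` under `μ`. -/
def joinPerm {z w : LabOp T.toCollection (fam T.toCollection X) i} (f : z ⟶ w) :
    Fin (join z).arity ≃ Fin (join w).arity :=
  blockPerm f.perm fun j => totPerm (f.lab j)

theorem joinPerm_symm {z w : LabOp T.toCollection (fam T.toCollection X) i} (f : z ⟶ w) (p) :
    finSigmaFinEquiv.symm (joinPerm f p) = posMap f (finSigmaFinEquiv.symm p) :=
  finSigmaFinEquiv.symm_apply_apply _

theorem join_op_eq {z w : LabOp T.toCollection (fam T.toCollection X) i} (f : z ⟶ w) :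
    (⟨(join z).op⟩ : T.Arrow i) = ⟨T.act (join w).op (joinPerm f)⟩ :=
  Eq.trans (T.comp_congr f.op_eq fun j => tot_op_eq (f.lab j))
    (T.equivariance w.op (fun j => (w.lab j).op) f.perm fun j => totPerm (f.lab j))

/-- The arrow part of `μ : T² X → T X`, sending `(ρ, (ρ_j, (β_jk)_k)_j)` to
`(ρ(ρ_j)_j, (β_jk)_jk)`. -/
def joinMap {z w : LabOp T.toCollection (fam T.toCollection X) i} (f : z ⟶ w) :
    join z ⟶ join w where
  perm := joinPerm f
  op_eq := join_op_eq f
  lab p := posLab f (finSigmaFinEquiv.symm p) ≫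
    eqToHom (congrArg (tot₂ w) (joinPerm_symm f p)).symm

theorem joinMap_lab_heq {z w : LabOp T.toCollection (fam T.toCollection X) i} (f : z ⟶ w) (p) :
    HEq ((joinMap f).lab p) (posLab f (finSigmaFinEquiv.symm p)) :=
  comp_eqToHom_heq _ _

theorem joinMap_id (z : LabOp T.toCollection (fam T.toCollection X) i) :
    joinMap (𝟙 z) = 𝟙 (join z) :=
  hom_ext _ _ (Equiv.ext fun p => finSigmaFinEquiv.symm.injective (joinPerm_symm _ p))
    fun p => (joinMap_lab_heq _ p).trans HEq.rfl

theorem joinMap_comp {z w v : LabOp T.toCollection (fam T.toCollection X) i} (f : z ⟶ w)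
    (g : w ⟶ v) : joinMap (f ≫ g) = joinMap f ≫ joinMap g := by
  refine hom_ext _ _ (Equiv.ext fun p => finSigmaFinEquiv.symm.injective ?_)
    fun p => (joinMap_lab_heq _ p).trans ((posLab_comp f g _).trans ?_)
  · refine (joinPerm_symm _ p).trans ((posMap_comp f g _).trans ?_)
    refine (Eq.trans ?_ (joinPerm_symm g _).symm)
    exact congrArg (posMap g) (joinPerm_symm f p).symm
  · refine heq_comp rfl (congrArg (tot₂ w) (joinPerm_symm f p)).symm ?_
      (joinMap_lab_heq f p).symm ?_
    · refine congrArg (tot₂ v) ((congrArg (posMap g) (joinPerm_symm f p).symm).trans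
        (joinPerm_symm g _).symm)
    · refine HEq.trans ?_ (joinMap_lab_heq g _).symm
      have : ∀ s t, s = t → HEq (posLab g s) (posLab g t) := by rintro s _ rfl; rfl
      exact this _ _ (joinPerm_symm f p).symm

/-- The multiplication `μ : T² X → T X`. -/
def mult (T : SymOperad I) (X : FamCat I) (i : I) :
    LabOp T.toCollection (fam T.toCollection X) i ⥤ LabOp T.toCollection X i where
  obj := join
  map := joinMap
  map_id := joinMap_id
  map_comp := joinMap_comp

end LabOp

namespace LabOp

variable {I : Type u} {T : SymOperad I} {X Y Z : FamCat I} {i : I}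

/-- `η`, as a 1-cell of `Cat/I`. -/
def famUnit (T : SymOperad I) (X : FamCat I) : X ⟶ fam T.toCollection X := unit T X

/-- `μ`, as a 1-cell of `Cat/I`. -/
def famMult (T : SymOperad I) (X : FamCat I) :
    fam T.toCollection (fam T.toCollection X) ⟶ fam T.toCollection X := mult T X

theorem functor_hext {C : Type*} [Category* C] (F G : C ⥤ LabOp T.toCollection X i)
    (h : ∀ z, F.obj z = G.obj z)
    (h' : ∀ {z w : C} (f : z ⟶ w) (j : Fin (F.obj z).arity) (k : Fin (G.obj z).arity),
      j.val = k.val → ((F.map f).perm j).val = ((G.map f).perm k).val ∧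
        HEq ((F.map f).lab j) ((G.map f).lab k)) : F = G :=
  CategoryTheory.Functor.hext h fun z w f => hom_hext (h z) (h w) _ _ (h' f)

theorem join_unit (a : LabOp T.toCollection X i) :
    join ((unit T (fam T.toCollection X) i).obj a) = a := by
  refine ext_tot (T.one_comp a.op) fun j k h => ?_
  have h' : (finSigmaFinEquiv.symm j).2 = k :=
    Fin.ext ((finSigma_symm_one (m := fun _ => a.arity) j).trans h)
  exact congrArg a.tot h'

theorem unit_mult (X : FamCat I) (i : I) :
    unit T (fam T.toCollection X) i ⋙ mult T X i = 𝟭 (LabOp T.toCollection X i) := by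
  refine functor_hext _ _ join_unit fun {a b} f j k h => ?_
  have h' : (finSigmaFinEquiv.symm j).2 = k :=
    Fin.ext ((finSigma_symm_one (m := fun _ => a.arity) j).trans h)
  subst h'
  refine ⟨?_, joinMap_lab_heq _ _⟩
  refine (finSigma_symm_one (m := fun _ => b.arity) _).symm.trans ?_
  exact congrArg (fun s : (_ : Fin 1) × Fin b.arity => s.2.val)
    (joinPerm_symm ((unit T (fam T.toCollection X) i).map f) j)

theorem join_map_unit (a : LabOp T.toCollection X i) :
    join ((map (famUnit T X) i).obj a) = a := by
  refine ext_tot (T.comp_one a.op) fun j k h => ?_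
  have h' : (finSigmaFinEquiv.symm j).1 = k :=
    Fin.ext ((finSigma_symm_ones (n := a.arity) j).trans h)
  exact congrArg a.tot h'

theorem totPerm_unit {p q : Σ i, X i} (g : p ⟶ q) :
    totPerm ((Sigma.Functor.sigma (unit T X)).map g) = Equiv.refl (Fin 1) := by
  obtain ⟨g⟩ := g; rfl

theorem totLab_unit {p q : Σ i, X i} (g : p ⟶ q) (k) :
    HEq (totLab ((Sigma.Functor.sigma (unit T X)).map g) k) g := by
  obtain ⟨g⟩ := g; rfl

theorem map_unit_mult (X : FamCat I) (i : I) :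
    map (famUnit T X) i ⋙ mult T X i = 𝟭 (LabOp T.toCollection X i) := by
  refine functor_hext _ _ join_map_unit fun {a b} f j k h => ?_
  have h' : (finSigmaFinEquiv.symm j).1 = k :=
    Fin.ext ((finSigma_symm_ones (n := a.arity) j).trans h)
  subst h'
  refine ⟨?_, (joinMap_lab_heq _ _).trans (totLab_unit _ _)⟩
  refine (finSigma_symm_ones (n := b.arity) _).symm.trans ?_
  exact congrArg (fun s : (_ : Fin b.arity) × Fin 1 => s.1.val)
    (joinPerm_symm ((map (famUnit T X) i).map f) j)

theorem totPerm_map (F : X ⟶ Y) {p q : Σ i, LabOp T.toCollection X i} (g : p ⟶ q) :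
    totPerm ((Sigma.Functor.sigma (map (T := T.toCollection) F)).map g) = totPerm g := by
  obtain ⟨g⟩ := g; rfl

theorem totLab_map (F : X ⟶ Y) {p q : Σ i, LabOp T.toCollection X i} (g : p ⟶ q) (k) :
    HEq (totLab ((Sigma.Functor.sigma (map (T := T.toCollection) F)).map g) k)
      ((Sigma.Functor.sigma F).map (totLab g k)) := by
  obtain ⟨g⟩ := g; rfl

theorem sigma_map_heq (F : X ⟶ Y) {p q p' q' : Σ i, X i} {g : p ⟶ q} {g' : p' ⟶ q'} (h : p = p')
    (h' : q = q') (hg : HEq g g') :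
    HEq ((Sigma.Functor.sigma F).map g) ((Sigma.Functor.sigma F).map g') := by
  subst h h' hg; rfl

theorem mult_natural (F : X ⟶ Y) (i : I) :
    map (famMap T.toCollection F) i ⋙ mult T Y i = mult T X i ⋙ map F i := by
  refine functor_hext _ _ (fun _ => rfl) fun {a b} f j k h => ?_
  obtain rfl := Fin.ext h
  have e : finSigmaFinEquiv.symm (joinPerm ((map (famMap T.toCollection F) i).map f) j) =
      finSigmaFinEquiv.symm (joinPerm f j) := by
    refine (joinPerm_symm _ _).trans (Eq.trans ?_ (joinPerm_symm f j).symm)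
    exact Sigma.ext rfl (heq_of_eq (DFunLike.congr_fun (totPerm_map F (f.lab _)) _))
  refine ⟨congrArg Fin.val (finSigmaFinEquiv.symm.injective e),
    (joinMap_lab_heq _ _).trans ((totLab_map F _ _).trans ?_)⟩
  exact sigma_map_heq F rfl (congrArg (tot₂ b) (joinPerm_symm f j)).symm (joinMap_lab_heq f j).symm

theorem mult_natural₂ {F G : X ⟶ Y} (θ : F ⟶ G) (i : I)
    (z : LabOp T.toCollection (fam T.toCollection X) i) :
    joinMap ((map₂ (famMap₂ T.toCollection θ) i).app z) = (map₂ θ i).app (join z) := by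
  refine hom_ext _ _ (Equiv.ext fun j => finSigmaFinEquiv.symm.injective ?_) fun j => ?_
  · exact joinPerm_symm _ _
  · exact (joinMap_lab_heq _ _).trans HEq.rfl

/-- The label of `z` at the position `s`. -/
abbrev tot₃ (z : LabOp T.toCollection (fam T.toCollection (fam T.toCollection X)) i)
    (s : (j : Fin z.arity) × (k : Fin (z.lab j).arity) × Fin ((z.lab j).lab k).arity) :
    Σ i, X i := ((z.lab s.1).lab s.2.1).tot s.2.2

theorem join_join (z : LabOp T.toCollection (fam T.toCollection (fam T.toCollection X)) i) :
    join (join z) = join ((map (famMult T X) i).obj z) := by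
  refine ext_tot ?_ ?_
  · exact (T.assoc z.op (fun j => (z.lab j).op) fun j k => ((z.lab j).lab k).op).symm
  · intro p q h
    exact congrArg (tot₃ z) (path_eq (l := fun j k => ((z.lab j).lab k).arity) q p h.symm).symm

/-- The position to which `f` moves the position `s`. -/
def posMap₃ {z w : LabOp T.toCollection (fam T.toCollection (fam T.toCollection X)) i} (f : z ⟶ w)
    (s : (j : Fin z.arity) × (k : Fin (z.lab j).arity) × Fin ((z.lab j).lab k).arity) :
    (j : Fin w.arity) × (k : Fin (w.lab j).arity) × Fin ((w.lab j).lab k).arity :=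
  ⟨f.perm s.1, totPerm (f.lab s.1) s.2.1, totPerm (totLab (f.lab s.1) s.2.1) s.2.2⟩

theorem totPerm_eqToHom {w : LabOp T.toCollection (fam T.toCollection (fam T.toCollection X)) i}
    {s t : (j : Fin w.arity) × Fin (w.lab j).arity} (h : s = t)
    {a : Σ i, fam T.toCollection X i} (g : a ⟶ tot₂ w t) (x : Fin a.2.arity) :
    (⟨s.1, s.2, totPerm (g ≫ eqToHom (congrArg (tot₂ w) h).symm) x⟩ :
      (j : Fin w.arity) × (k : Fin (w.lab j).arity) × Fin ((w.lab j).lab k).arity) =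
      ⟨t.1, t.2, totPerm g x⟩ := by
  subst h
  exact congrArg (fun g' : a ⟶ tot₂ w s =>
    (⟨s.1, s.2, totPerm g' x⟩ :
      (j : Fin w.arity) × (k : Fin (w.lab j).arity) × Fin ((w.lab j).lab k).arity))
    (Category.comp_id g)

theorem totLab_eqToHom {a b c : Σ i, LabOp T.toCollection X i} (g : a ⟶ b) (h : b = c) (x) :
    HEq (totLab (g ≫ eqToHom h) x) (totLab g x) := by
  subst h
  rw [eqToHom_refl, Category.comp_id]

theorem totPerm_mult {p q : Σ i, LabOp T.toCollection (fam T.toCollection X) i} (g : p ⟶ q)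
    (y : Fin (join p.2).arity) :
    finSigmaFinEquiv.symm (totPerm ((Sigma.Functor.sigma (mult T X)).map g) y) =
      (⟨totPerm g (finSigmaFinEquiv.symm y).1,
        totPerm (totLab g (finSigmaFinEquiv.symm y).1) (finSigmaFinEquiv.symm y).2⟩ :
          (j : Fin q.2.arity) × Fin (q.2.lab j).arity) := by
  obtain ⟨g⟩ := g
  exact joinPerm_symm g y

theorem totLab_mult {p q : Σ i, LabOp T.toCollection (fam T.toCollection X) i} (g : p ⟶ q)
    (y : Fin (join p.2).arity) :
    HEq (totLab ((Sigma.Functor.sigma (mult T X)).map g) y)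
      (totLab (totLab g (finSigmaFinEquiv.symm y).1) (finSigmaFinEquiv.symm y).2) := by
  obtain ⟨g⟩ := g
  exact joinMap_lab_heq g y

theorem mult_assoc (X : FamCat I) (i : I) :
    mult T (fam T.toCollection X) i ⋙ mult T X i = map (famMult T X) i ⋙ mult T X i := by
  refine functor_hext _ _ join_join fun {z w} f p q h => ?_
  have hs : pathInner (l := fun j k => ((z.lab j).lab k).arity) q =
      pathOuter (l := fun j k => ((z.lab j).lab k).arity) p := path_eq _ _ h.symm
  have h₁ : pathOuter (l := fun j k => ((w.lab j).lab k).arity)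
      ((joinMap (joinMap f)).perm p) =
        posMap₃ f (pathOuter (l := fun j k => ((z.lab j).lab k).arity) p) := by
    have e := joinPerm_symm (joinMap f) p
    have e' := totPerm_eqToHom (joinPerm_symm f (finSigmaFinEquiv.symm p).1)
      (posLab f (finSigmaFinEquiv.symm (finSigmaFinEquiv.symm p).1)) (finSigmaFinEquiv.symm p).2
    refine Eq.trans ?_ e'
    exact congrArg (fun r : (j : Fin (join w).arity) × Fin ((join w).lab j).arity =>
      (⟨(finSigmaFinEquiv.symm r.1).1, (finSigmaFinEquiv.symm r.1).2, r.2⟩ :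
        (j : Fin w.arity) × (k : Fin (w.lab j).arity) × Fin ((w.lab j).lab k).arity)) e
  have h₂ : pathInner (l := fun j k => ((w.lab j).lab k).arity)
      ((joinMap ((map (famMult T X) i).map f)).perm q) = posMap₃ f (pathInner q) := by
    have e := joinPerm_symm ((map (famMult T X) i).map f) q
    have e' := totPerm_mult (f.lab (finSigmaFinEquiv.symm q).1) (finSigmaFinEquiv.symm q).2
    refine (congrArg (fun r : (j : Fin w.arity) × Fin (join (w.lab j)).arity =>
      (⟨r.1, finSigmaFinEquiv.symm r.2⟩ :
        (j : Fin w.arity) × (k : Fin (w.lab j).arity) × Fin ((w.lab j).lab k).arity)) e).trans ?_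
    exact congrArg (Sigma.mk (f.perm (finSigmaFinEquiv.symm q).1)) e'
  refine ⟨(val_eq_of_path_eq (h₂.trans ((congrArg (posMap₃ f) hs).trans h₁.symm))).symm, ?_⟩
  refine (joinMap_lab_heq _ _).trans ((totLab_eqToHom _ _ _).trans (HEq.trans ?_
    ((joinMap_lab_heq ((map (famMult T X) i).map f) q).trans
      (totLab_mult (f.lab (finSigmaFinEquiv.symm q).1) (finSigmaFinEquiv.symm q).2)).symm))
  have key : ∀ s t : (j : Fin z.arity) × (k : Fin (z.lab j).arity) × Fin ((z.lab j).lab k).arity,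
      s = t → HEq (totLab (totLab (f.lab s.1) s.2.1) s.2.2)
        (totLab (totLab (f.lab t.1) t.2.1) t.2.2) := by
    rintro s _ rfl; rfl
  exact key _ _ hs.symm

/-- The 2-monad on `Cat/I` associated to an operad with object set `I`. -/
def _root_.SymOperad.twoMonad (T : SymOperad I) : TwoMonad (FamCat I) where
  toStrictPseudofunctor := twoFunctor T.toCollection
  η := famUnit T
  η_naturality _ := rfl
  η_naturality₂ θ := FamCat.hom₂_ext fun i a =>
    eq_of_heq (FamCat.heq_app _ (famUnit T _ ◁ famMap₂ T.toCollection θ) _ i a).symm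
  μ := famMult T
  μ_naturality F := funext (mult_natural F)
  μ_naturality₂ θ := FamCat.hom₂_ext fun i a =>
    eq_of_heq (HEq.trans (heq_of_eq (mult_natural₂ θ i a))
      (FamCat.heq_app _ (famMult T _ ◁ famMap₂ T.toCollection θ) _ i a).symm)
  η_μ X := funext (unit_mult X)
  map_η_μ X := funext (map_unit_mult X)
  μ_assoc X := funext (mult_assoc X)

end LabOp

/-- The concatenation of families of objects, as a functor `∏_j ∏_k H (d j k) ⥤ ∏_jk H (d j k)`. -/
def concatFunctor {I : Type u} (H : FamCat I) {n : ℕ} {m : Fin n → ℕ}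
    (d : (j : Fin n) → Fin (m j) → I) :
    ((j : Fin n) → (k : Fin (m j)) → H (d j k)) ⥤ ((p : Fin (∑ j, m j)) → H (concat d p)) where
  obj x := concat x
  map f := concat f

/-- The products of an operad morphism into `Cat` with object map `H`: a functor `H_α` for each
arrow `α`. -/
structure Products {I : Type u} (T : Collection I) (H : FamCat I) where
  /-- the functor `H_α` -/
  prod {n : ℕ} {c : Fin n → I} {i : I} (α : T.Hom c i) : ((j : Fin n) → H (c j)) ⥤ H i

/-- The object `H_α(x_j)_j`. -/
def Products.ev {I : Type u} {T : Collection I} {H : FamCat I} (P : Products T H) {i : I}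
    (a : LabOp T H i) : H i := (P.prod a.op).obj a.lab

section labelled

variable {I : Type u} {T : SymOperad I} {X : FamCat I} {i : I}

-- Equalities of labelled operations, which type the axioms below.

theorem lab_act_one {n : ℕ} {c : Fin n → I} (α : T.Hom c i) (x : ∀ j, X (c j)) :
    (⟨T.act α (Equiv.refl (Fin n)), x⟩ : LabOp T.toCollection X i) = ⟨α, x⟩ :=
  congrArg (fun α' => (⟨α', x⟩ : LabOp T.toCollection X i)) (T.act_one α)

theorem lab_act_mul {l m n : ℕ} {c : Fin n → I} (α : T.Hom c i) (ρ : Fin m ≃ Fin n)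
    (τ : Fin l ≃ Fin m) (x : ∀ j, X (c j)) :
    (⟨T.act (T.act α ρ) τ, fun j => x (ρ (τ j))⟩ : LabOp T.toCollection X i) =
      ⟨T.act α (τ.trans ρ), fun j => x (ρ (τ j))⟩ :=
  congrArg (fun α' => (⟨α', fun j => x (ρ (τ j))⟩ : LabOp T.toCollection X i)) (T.act_mul α ρ τ)

theorem lab_one_comp {n : ℕ} {c : Fin n → I} (α : T.Hom c i) (x : ∀ j, X (c j)) :
    (⟨T.comp (T.one i) fun _ => α, concat fun _ => x⟩ : LabOp T.toCollection X i) = ⟨α, x⟩ :=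
  LabOp.join_unit ⟨α, x⟩

theorem lab_comp_one {n : ℕ} {c : Fin n → I} (α : T.Hom c i) (x : ∀ j, X (c j)) :
    (⟨T.comp α fun j => T.one (c j), concat fun j _ => x j⟩ : LabOp T.toCollection X i) =
      ⟨α, x⟩ :=
  LabOp.join_map_unit ⟨α, x⟩

theorem lab_assoc {n : ℕ} {c : Fin n → I} (α : T.Hom c i) {m : Fin n → ℕ}
    {d : (j : Fin n) → Fin (m j) → I} (β : ∀ j, T.Hom (d j) (c j))
    {l : (j : Fin n) → Fin (m j) → ℕ} {e : (j : Fin n) → (k : Fin (m j)) → Fin (l j k) → I}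
    (γ : ∀ j k, T.Hom (e j k) (d j k)) (x : ∀ j k r, X (e j k r)) :
    (⟨T.comp (T.comp α β) (concat γ), concat (concat x)⟩ : LabOp T.toCollection X i) =
      ⟨T.comp α fun j => T.comp (β j) (γ j), concat fun j => concat (x j)⟩ :=
  LabOp.join_join ⟨α, fun j => ⟨β j, fun k => ⟨γ j k, x j k⟩⟩⟩

theorem lab_equivariance {n' n : ℕ} {c : Fin n → I} (α : T.Hom c i) {m : Fin n → ℕ}
    {d : (j : Fin n) → Fin (m j) → I} (β : ∀ j, T.Hom (d j) (c j)) (ρ : Fin n' ≃ Fin n)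
    {m' : Fin n' → ℕ} (τ : ∀ j, Fin (m' j) ≃ Fin (m (ρ j))) (x : ∀ j k, X (d j k)) :
    (⟨T.comp (T.act α ρ) fun j => T.act (β (ρ j)) (τ j), concat fun j k => x (ρ j) (τ j k)⟩ :
        LabOp T.toCollection X i) =
      ⟨T.act (T.comp α β) (blockPerm ρ τ), fun p => concat x (blockPerm ρ τ p)⟩ := by
  refine LabOp.ext_tot (T.equivariance α β ρ τ) fun p q h => ?_
  obtain rfl := Fin.ext h
  exact congrArg (fun s : (j : Fin n) × Fin (m j) => (⟨d s.1 s.2, x s.1 s.2⟩ : Σ i, X i))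
    (finSigmaFinEquiv.symm_apply_apply (⟨ρ _, τ _ _⟩ : (j : Fin n) × Fin (m j))).symm

end labelled

/-- A lax morphism of operads `T → Cat` with object map `H`. The axioms are stated in components,
and the canonical isomorphisms `eqToHom` relate the values of `H` at equal labelled operations. -/
structure LaxOperadMorphism {I : Type u} (T : SymOperad I) (H : FamCat I) extends
    Products T.toCollection H where
  /-- the symmetries `ξ_{α,ρ} : H_{αρ} c_ρ ⟶ H_α` -/
  ξ {m n : ℕ} {c : Fin n → I} {i : I} (α : T.Hom c i) (ρ : Fin m ≃ Fin n) :
    Pi.comap (fun j => H (c j)) ρ ⋙ prod (T.act α ρ) ⟶ prod α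
  /-- the units `ν_i : 1 ⟶ H_{1_i}` -/
  ν (i : I) : 𝟭 (H i) ⟶ Functor.pi' (fun _ : Fin 1 => 𝟭 (H i)) ⋙ prod (T.one i)
  /-- the substitutions `σ_{α,(β_j)_j} : H_α (∏_j H_{β_j}) ⟶ H_{α(β_j)_j}` -/
  σ {n : ℕ} {c : Fin n → I} {i : I} (α : T.Hom c i) {m : Fin n → ℕ}
    {d : (j : Fin n) → Fin (m j) → I} (β : ∀ j, T.Hom (d j) (c j)) :
    Functor.pi (fun j => prod (β j)) ⋙ prod α ⟶ concatFunctor H d ⋙ prod (T.comp α β)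
  ξ_one {n : ℕ} {c : Fin n → I} {i : I} (α : T.Hom c i) (x : ∀ j, H (c j)) :
    (ξ α (Equiv.refl (Fin n))).app x =
      eqToHom (congrArg toProducts.ev (lab_act_one α x))
  ξ_mul {l m n : ℕ} {c : Fin n → I} {i : I} (α : T.Hom c i) (ρ : Fin m ≃ Fin n)
    (τ : Fin l ≃ Fin m) (x : ∀ j, H (c j)) :
    eqToHom (congrArg toProducts.ev (lab_act_mul α ρ τ x)) ≫ (ξ α (τ.trans ρ)).app x =
      (ξ (T.act α ρ) τ).app (fun j => x (ρ j)) ≫ (ξ α ρ).app x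
  prod_ν {n : ℕ} {c : Fin n → I} {i : I} (α : T.Hom c i) (x : ∀ j, H (c j)) :
    (prod α).map (fun j => (ν (c j)).app (x j)) ≫ (σ α fun j => T.one (c j)).app (fun j _ => x j) =
      eqToHom (congrArg toProducts.ev (lab_comp_one α x)).symm
  ν_prod {n : ℕ} {c : Fin n → I} {i : I} (α : T.Hom c i) (x : ∀ j, H (c j)) :
    (ν i).app ((prod α).obj x) ≫ (σ (T.one i) fun _ => α).app (fun _ => x) =
      eqToHom (congrArg toProducts.ev (lab_one_comp α x)).symm
  ξ_σ {n' n : ℕ} {c : Fin n → I} {i : I} (α : T.Hom c i) {m : Fin n → ℕ}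
    {d : (j : Fin n) → Fin (m j) → I} (β : ∀ j, T.Hom (d j) (c j)) (ρ : Fin n' ≃ Fin n)
    {m' : Fin n' → ℕ} (τ : ∀ j, Fin (m' j) ≃ Fin (m (ρ j))) (x : ∀ j k, H (d j k)) :
    (σ (T.act α ρ) fun j => T.act (β (ρ j)) (τ j)).app (fun j k => x (ρ j) (τ j k)) ≫
        eqToHom (congrArg toProducts.ev (lab_equivariance α β ρ τ x)) ≫
          (ξ (T.comp α β) (blockPerm ρ τ)).app (concat x) =
      (prod (T.act α ρ)).map (fun j => (ξ (β (ρ j)) (τ j)).app (x (ρ j))) ≫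
        (ξ α ρ).app (fun j => (prod (β j)).obj (x j)) ≫ (σ α β).app x
  σ_σ {n : ℕ} {c : Fin n → I} {i : I} (α : T.Hom c i) {m : Fin n → ℕ}
    {d : (j : Fin n) → Fin (m j) → I} (β : ∀ j, T.Hom (d j) (c j))
    {l : (j : Fin n) → Fin (m j) → ℕ} {e : (j : Fin n) → (k : Fin (m j)) → Fin (l j k) → I}
    (γ : ∀ j k, T.Hom (e j k) (d j k)) (x : ∀ j k r, H (e j k r)) :
    (σ α β).app (fun j k => (prod (γ j k)).obj (x j k)) ≫
        (σ (T.comp α β) (concat γ)).app (concat x) ≫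
          eqToHom (congrArg toProducts.ev (lab_assoc α β γ x)) =
      (prod α).map (fun j => (σ (β j) (γ j)).app (x j)) ≫
        (σ α fun j => T.comp (β j) (γ j)).app (fun j => concat (x j))

section naturalTransformations

variable {I : Type u} {T : SymOperad I} {H K : FamCat I}

/-- The structure of a lax-natural transformation `H ⟶ K` on the family of functors `f`. -/
structure LaxNatural (M : LaxOperadMorphism T H) (N : LaxOperadMorphism T K) (f : H ⟶ K) where
  /-- the natural transformation `K_α (∏_j f_{i_j}) ⟶ f_i H_α` -/
  cell {n : ℕ} {c : Fin n → I} {i : I} (α : T.Hom c i) :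
    Functor.pi (fun j => f (c j)) ⋙ N.prod α ⟶ M.prod α ⋙ f i
  cell_ξ {m n : ℕ} {c : Fin n → I} {i : I} (α : T.Hom c i) (ρ : Fin m ≃ Fin n)
    (x : ∀ j, H (c j)) :
    (cell (T.act α ρ)).app (fun j => x (ρ j)) ≫ (f i).map ((M.ξ α ρ).app x) =
      (N.ξ α ρ).app (fun j => (f (c j)).obj (x j)) ≫ (cell α).app x
  cell_ν (i : I) (x : H i) :
    (N.ν i).app ((f i).obj x) ≫ (cell (T.one i)).app (fun _ => x) = (f i).map ((M.ν i).app x)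
  cell_σ {n : ℕ} {c : Fin n → I} {i : I} (α : T.Hom c i) {m : Fin n → ℕ}
    {d : (j : Fin n) → Fin (m j) → I} (β : ∀ j, T.Hom (d j) (c j)) (x : ∀ j k, H (d j k)) :
    (N.σ α β).app (fun j k => (f (d j k)).obj (x j k)) ≫ (cell (T.comp α β)).app (concat x) =
      (N.prod α).map (fun j => (cell (β j)).app (x j)) ≫
        (cell α).app (fun j => (M.prod (β j)).obj (x j)) ≫ (f i).map ((M.σ α β).app x)

/-- The structure of a colax-natural transformation `H ⟶ K` on the family of functors `f`. -/
structure ColaxNatural (M : LaxOperadMorphism T H) (N : LaxOperadMorphism T K) (f : H ⟶ K) where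
  /-- the natural transformation `f_i H_α ⟶ K_α (∏_j f_{i_j})` -/
  cell {n : ℕ} {c : Fin n → I} {i : I} (α : T.Hom c i) :
    M.prod α ⋙ f i ⟶ Functor.pi (fun j => f (c j)) ⋙ N.prod α
  cell_ξ {m n : ℕ} {c : Fin n → I} {i : I} (α : T.Hom c i) (ρ : Fin m ≃ Fin n)
    (x : ∀ j, H (c j)) :
    (cell (T.act α ρ)).app (fun j => x (ρ j)) ≫ (N.ξ α ρ).app (fun j => (f (c j)).obj (x j)) =
      (f i).map ((M.ξ α ρ).app x) ≫ (cell α).app x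
  cell_ν (i : I) (x : H i) :
    (f i).map ((M.ν i).app x) ≫ (cell (T.one i)).app (fun _ => x) = (N.ν i).app ((f i).obj x)
  cell_σ {n : ℕ} {c : Fin n → I} {i : I} (α : T.Hom c i) {m : Fin n → ℕ}
    {d : (j : Fin n) → Fin (m j) → I} (β : ∀ j, T.Hom (d j) (c j)) (x : ∀ j k, H (d j k)) :
    (f i).map ((M.σ α β).app x) ≫ (cell (T.comp α β)).app (concat x) =
      (cell α).app (fun j => (M.prod (β j)).obj (x j)) ≫
        (N.prod α).map (fun j => (cell (β j)).app (x j)) ≫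
          (N.σ α β).app (fun j k => (f (d j k)).obj (x j k))

/-- The structure of a pseudo-natural transformation: a lax-natural one with invertible cells. -/
structure PseudoNatural (M : LaxOperadMorphism T H) (N : LaxOperadMorphism T K) (f : H ⟶ K) extends
    LaxNatural M N f where
  isIso_cell {n : ℕ} {c : Fin n → I} {i : I} (α : T.Hom c i) : IsIso (cell α)

/-- The structure of a natural transformation: a lax-natural one whose cells are identities. -/
structure StrictNatural (M : LaxOperadMorphism T H) (N : LaxOperadMorphism T K) (f : H ⟶ K) extends
    LaxNatural M N f where
  comm {n : ℕ} {c : Fin n → I} {i : I} (α : T.Hom c i) :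
    Functor.pi (fun j => f (c j)) ⋙ N.prod α = M.prod α ⋙ f i
  cell_eq {n : ℕ} {c : Fin n → I} {i : I} (α : T.Hom c i) : cell α = eqToHom (comm α)

end naturalTransformations

namespace FamCat

variable {I : Type u} {X Y : FamCat I} {F F' G G' L L' : X ⟶ Y}

theorem comp₅_app (e₁ : F = F') (θ : F' ⟶ G) (e₂ : G = G') (φ : G' ⟶ L) (e₃ : L = L') (i : I)
    (x : X i) :
    ((eqToHom e₁ ≫ θ ≫ eqToHom e₂ ≫ φ ≫ eqToHom e₃) i).app x =
      eqToHom (congrArg (fun F : X ⟶ Y => (F i).obj x) e₁) ≫ (θ i).app x ≫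
        eqToHom (congrArg (fun F : X ⟶ Y => (F i).obj x) e₂) ≫ (φ i).app x ≫
          eqToHom (congrArg (fun F : X ⟶ Y => (F i).obj x) e₃) := by
  subst e₁ e₂ e₃; rfl

theorem comp₃_app (θ : F ⟶ G) (e : G = G') (φ : G' ⟶ L) (i : I) (x : X i) :
    ((θ ≫ eqToHom e ≫ φ) i).app x =
      (θ i).app x ≫ eqToHom (congrArg (fun F : X ⟶ Y => (F i).obj x) e) ≫ (φ i).app x := by
  subst e; rfl

end FamCat

namespace LabOp

variable {I : Type u} {T : Collection I} {X : FamCat I} {i : I}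

/-- The domain of the morphism of `X i` underlying a morphism `p ⟶ (i, x)` of the total category. -/
def pull : ∀ {p q : Σ i, X i}, (p ⟶ q) → X q.1
  | _, _, .mk (X := x) _ => x

/-- The morphism of `X i` underlying a morphism of the total category. -/
def pullHom : ∀ {p q : Σ i, X i} (g : p ⟶ q), pull g ⟶ q.2
  | _, _, .mk g => g

theorem pull_eq : ∀ {p q : Σ i, X i} (g : p ⟶ q), p = ⟨q.1, pull g⟩
  | _, _, .mk _ => rfl

theorem exists_mk : ∀ {i : I} {x y : X i} (g : (⟨i, x⟩ : Σ i, X i) ⟶ ⟨i, y⟩),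
    ∃ γ : x ⟶ y, g = (Sigma.SigmaHom.mk γ : (⟨i, x⟩ : Σ i, X i) ⟶ ⟨i, y⟩)
  | _, _, _, .mk γ => ⟨γ, rfl⟩

/-- The morphism `(βρ, (x_j)_j) ⟶ (β, (y_j)_j)` given by `ρ` and the morphisms `x_j ⟶ y_{ρ j}`. -/
def can (b : LabOp T X i) {m : ℕ} (ρ : Fin m ≃ Fin b.arity) (x : ∀ j, X (b.src (ρ j)))
    (γ : ∀ j, x j ⟶ b.lab (ρ j)) : (⟨T.act b.op ρ, x⟩ : LabOp T X i) ⟶ b :=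
  ⟨ρ, rfl, fun j : Fin m => Sigma.SigmaHom.mk (γ j)⟩

theorem exists_can' {n : ℕ} {c : Fin n → I} {α : T.Hom c i} {x : ∀ j, X (c j)} {b : LabOp T X i}
    (ρ : Fin n ≃ Fin b.arity) (h : (⟨α⟩ : T.Arrow i) = ⟨T.act b.op ρ⟩)
    (l : ∀ j, (⟨c j, x j⟩ : Σ i, X i) ⟶ b.tot (ρ j)) :
    ∃ (m : ℕ) (ρ' : Fin m ≃ Fin b.arity) (x' : ∀ j, X (b.src (ρ' j)))
      (γ : ∀ j, x' j ⟶ b.lab (ρ' j)),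
      (⟨⟨α, x⟩, ⟨ρ, h, l⟩⟩ : Σ a, Hom a b) = ⟨⟨T.act b.op ρ', x'⟩, can b ρ' x' γ⟩ := by
  have h' := h
  rw [Collection.Arrow.mk.injEq] at h'
  obtain ⟨-, hs, hb⟩ := h'
  obtain rfl := eq_of_heq hs
  obtain rfl := eq_of_heq hb
  choose γ hγ using fun j => exists_mk (l j)
  obtain rfl := funext hγ
  exact ⟨_, ρ, x, γ, rfl⟩

theorem exists_can {a b : LabOp T X i} (f : a ⟶ b) :
    ∃ (m : ℕ) (ρ : Fin m ≃ Fin b.arity) (x : ∀ j, X (b.src (ρ j))) (γ : ∀ j, x j ⟶ b.lab (ρ j)),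
      (⟨a, f⟩ : Σ a, Hom a b) = ⟨⟨T.act b.op ρ, x⟩, can b ρ x γ⟩ :=
  exists_can' f.perm f.op_eq f.lab

theorem src_eq {a b : LabOp T X i} (f : a ⟶ b) :
    a = ⟨T.act b.op f.perm, fun j => pull (f.lab j)⟩ := by
  refine ext_tot f.op_eq fun j k h => ?_
  obtain rfl := Fin.ext h
  exact pull_eq (f.lab j)

theorem pullHom_comp_eqToHom {j : I} {x y : X j} (g : x ⟶ y) {r : Σ i, X i} (h : ⟨j, y⟩ = r) :
    (⟨j, x, y, g⟩ : Σ (i : I) (x y : X i), (x ⟶ y)) =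
      ⟨r.1, pull ((Sigma.SigmaHom.mk g : (⟨j, x⟩ : Σ i, X i) ⟶ ⟨j, y⟩) ≫ eqToHom h), r.2,
        pullHom ((Sigma.SigmaHom.mk g : (⟨j, x⟩ : Σ i, X i) ⟶ ⟨j, y⟩) ≫ eqToHom h)⟩ := by
  subst h
  rw [eqToHom_refl, Category.comp_id]
  rfl

end LabOp

namespace Products

variable {I : Type u} {T : Collection I} {H : FamCat I} {i : I} (P : Products T H)

theorem eqToHom_map {n : ℕ} {c : Fin n → I} {α α' : T.Hom c i} (h : α = α')
    {x y : ∀ j, H (c j)} (g : x ⟶ y) (hx : (P.prod α).obj x = (P.prod α').obj x)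
    (hy : (P.prod α).obj y = (P.prod α').obj y) :
    eqToHom hx ≫ (P.prod α').map g = (P.prod α).map g ≫ eqToHom hy := by
  subst h
  rw [eqToHom_refl, eqToHom_refl, Category.id_comp, Category.comp_id]

theorem map_heq {n n' : ℕ} {c : Fin n → I} {c' : Fin n' → I} {α : T.Hom c i} {α' : T.Hom c' i}
    (h : (⟨α⟩ : T.Arrow i) = ⟨α'⟩) {x y : ∀ j, H (c j)} {x' y' : ∀ j, H (c' j)}
    (g : ∀ j, x j ⟶ y j) (g' : ∀ j, x' j ⟶ y' j)
    (hg : ∀ (j : Fin n) (j' : Fin n'), j.val = j'.val →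
      (⟨c j, x j, y j, g j⟩ : Σ (i : I) (x y : H i), (x ⟶ y)) = ⟨c' j', x' j', y' j', g' j'⟩) :
    HEq ((P.prod α).map (X := x) (Y := y) g) ((P.prod α').map (X := x') (Y := y') g') := by
  cases h
  have h₀ : (fun j => (⟨x j, y j, g j⟩ : Σ (x y : H (c j)), (x ⟶ y))) =
      fun j => ⟨x' j, y' j, g' j⟩ :=
    funext fun j => eq_of_heq (Sigma.mk.inj (hg j j rfl)).2
  exact congr_arg_heq (fun G : (j : Fin n) → Σ (x y : H (c j)), (x ⟶ y) =>
    (P.prod α).map (X := fun j => (G j).1) (Y := fun j => (G j).2.1) fun j => (G j).2.2) h₀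

end Products

namespace LaxOperadMorphism

section lemmas

variable {C : Type*} [Category* C]

theorem eqToHom_cancel {A B D : C} (h : A = B) (h' : B = A) (g : A ⟶ D) :
    eqToHom h ≫ eqToHom h' ≫ g = g := by
  rw [← Category.assoc, eqToHom_trans]
  exact Category.id_comp _

theorem comp_aux {A A' B B' D F G : C} {e : A ⟶ A'} {m₂ : A' ⟶ B'} {m₁ : A ⟶ B} {e' : B ⟶ B'}
    {ξ : B' ⟶ G} {ξ₁ : B ⟶ F} {ξ₂ : F ⟶ G} {D' : C} {g₁ : A ⟶ D'} {g₂ : D' ⟶ B} {ξ₁' : D' ⟶ D}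
    {d : D ⟶ F} (h₁ : e ≫ m₂ = m₁ ≫ e') (h₂ : e' ≫ ξ = ξ₁ ≫ ξ₂) (h₃ : m₁ = g₁ ≫ g₂)
    (h₄ : g₂ ≫ ξ₁ = ξ₁' ≫ d) : e ≫ m₂ ≫ ξ = (g₁ ≫ ξ₁') ≫ d ≫ ξ₂ := by
  rw [← Category.assoc, h₁, Category.assoc, h₂, h₃, Category.assoc, ← Category.assoc g₂, h₄,
    Category.assoc, Category.assoc]

theorem subst_aux {A B D F G A' F' G' : C} {l : A ⟶ B} {s : B ⟶ G} {p : A ⟶ D} {x₁ : D ⟶ B}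
    {p₁ : A ⟶ A'} {p₂ : A' ⟶ D} {s' : A' ⟶ F'} {e : F' ⟶ G'} {ξ : G' ⟶ G} {s₀ : A ⟶ F}
    {g : F ⟶ F'} {r : F ⟶ G} (hl : l = p ≫ x₁) (hp : p = p₁ ≫ p₂)
    (hx : s' ≫ e ≫ ξ = p₂ ≫ x₁ ≫ s) (hn : p₁ ≫ s' = s₀ ≫ g) (hr : r = g ≫ e ≫ ξ) :
    l ≫ s = s₀ ≫ r := by
  rw [hl, hp, hr, Category.assoc, Category.assoc, ← hx, ← Category.assoc, hn, Category.assoc]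

theorem unit_aux {A A' B B' D : C} (e₁ : A = A') (p : A' ⟶ B) (e₂ : B = B') (q : B' ⟶ D)
    (e₃ : D = A) (h : p ≫ eqToHom e₂ ≫ q = eqToHom (e₁.symm.trans e₃.symm)) :
    eqToHom e₁ ≫ p ≫ eqToHom e₂ ≫ q ≫ eqToHom e₃ = 𝟙 A := by
  subst e₁ e₃ e₂
  simpa using h

theorem assoc_aux {A B D E F : C} {p : A ⟶ B} (e : B = B) {q : B ⟶ D} (e₁ : A = A)
    {p' : A ⟶ E} (e₂ : E = E) {q' : E ⟶ F} (e₃ : F = D) {r : A ⟶ E} (h : p' = r)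
    (h' : p ≫ q ≫ eqToHom e₃.symm = r ≫ q') :
    p ≫ eqToHom e ≫ q = eqToHom e₁ ≫ p' ≫ eqToHom e₂ ≫ q' ≫ eqToHom e₃ := by
  subst e₃ h
  simpa using h'

end lemmas

open LabOp

section action

variable {I : Type u} {T : SymOperad I} {H : FamCat I} {i : I} (M : LaxOperadMorphism T H)

/-- The action of `T H` on `H`, on morphisms: `(ρ, (γ_j)_j) : (βρ, (x_j)_j) ⟶ (β, (y_j)_j)` is sent
to the composite of `H_{βρ}(γ_j)_j` and the symmetry `ξ_{β,ρ}`. -/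
def actMap {a b : LabOp T.toCollection H i} (f : a ⟶ b) :
    M.toProducts.ev a ⟶ M.toProducts.ev b :=
  eqToHom (congrArg M.toProducts.ev (src_eq f)) ≫
    (M.prod (T.act b.op f.perm)).map (fun j => pullHom (f.lab j)) ≫ (M.ξ b.op f.perm).app b.lab

theorem actMap_can (b : LabOp T.toCollection H i) {m : ℕ} (ρ : Fin m ≃ Fin b.arity)
    (x : ∀ j, H (b.src (ρ j))) (γ : ∀ j, x j ⟶ b.lab (ρ j)) :
    M.actMap (can b ρ x γ) = (M.prod (T.act b.op ρ)).map γ ≫ (M.ξ b.op ρ).app b.lab :=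
  Category.id_comp _

theorem actMap_level (a : LabOp T.toCollection H i) (y : ∀ j, H (a.src j))
    (γ : ∀ j, a.lab j ⟶ y j)
    (h : (⟨a.op⟩ : T.Arrow i) = ⟨T.act a.op (Equiv.refl (Fin a.arity))⟩) :
    M.actMap (a := a) (b := ⟨a.op, y⟩) ⟨Equiv.refl (Fin a.arity), h,
      fun j : Fin a.arity => (Sigma.SigmaHom.mk (γ j) : a.tot j ⟶ ⟨a.src j, y j⟩)⟩ =
      (M.prod a.op).map γ := by
  refine Eq.trans (congrArg (fun e => _ ≫ _ ≫ e) (M.ξ_one a.op y)) ?_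
  have e := M.toProducts.eqToHom_map (T.act_one a.op) γ
    (congrArg M.toProducts.ev (lab_act_one a.op a.lab))
    (congrArg M.toProducts.ev (lab_act_one a.op y))
  refine Eq.trans (congrArg (fun e => _ ≫ e) e.symm) ?_
  exact eqToHom_cancel _ _ _

theorem actMap_id (a : LabOp T.toCollection H i) : M.actMap (𝟙 a) = 𝟙 (M.toProducts.ev a) :=
  (M.actMap_level a a.lab (fun j => 𝟙 (a.lab j)) (arrow_one a)).trans ((M.prod a.op).map_id a.lab)

theorem actMap_comp {a b c : LabOp T.toCollection H i} (f : a ⟶ b) (g : b ⟶ c) :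
    M.actMap (f ≫ g) = M.actMap f ≫ M.actMap g := by
  obtain ⟨m, τ, y, δ, hg⟩ := exists_can g
  cases hg
  obtain ⟨l, ρ, x, γ, hf⟩ := exists_can f
  cases hf
  rw [actMap_can, actMap_can]
  exact comp_aux
    (M.toProducts.eqToHom_map (T.act_mul c.op τ ρ)
      (x := x) (y := fun j => c.lab (τ (ρ j))) (fun j => γ j ≫ δ (ρ j)) _ _)
    (M.ξ_mul c.op τ ρ c.lab)
    ((M.prod (T.act (T.act c.op τ) ρ)).map_comp (X := x) γ (fun j => δ (ρ j)))
    ((M.ξ (T.act c.op τ) ρ).naturality δ)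

/-- The action of `T H` on `H`, given by `(α, (x_j)_j) ↦ H_α(x_j)_j`. -/
def act (i : I) : LabOp T.toCollection H i ⥤ H i where
  obj a := M.toProducts.ev a
  map f := M.actMap f
  map_id := M.actMap_id
  map_comp := M.actMap_comp

/-- The component of the substitution `σ` at a labelled operation of labelled operations. -/
def subst (z : LabOp T.toCollection (fam T.toCollection H) i) :
    M.toProducts.ev ⟨z.op, fun j => M.toProducts.ev (z.lab j)⟩ ⟶ M.toProducts.ev (join z) :=
  (M.σ z.op fun j => (z.lab j).op).app fun j => (z.lab j).lab

/-- The action, as a 1-cell of `Cat/I`. -/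
def famAct : fam T.toCollection H ⟶ H := M.act

theorem actMap_joinMap_can (w : LabOp T.toCollection (fam T.toCollection H) i) {n : ℕ}
    (ρ : Fin n ≃ Fin w.arity) {m : Fin n → ℕ} (τ : ∀ j, Fin (m j) ≃ Fin (w.lab (ρ j)).arity)
    (x : ∀ j k, H ((w.lab (ρ j)).src (τ j k))) (γ : ∀ j k, x j k ⟶ (w.lab (ρ j)).lab (τ j k)) :
    M.actMap (joinMap (can w ρ
      (fun j => (⟨T.act (w.lab (ρ j)).op (τ j), x j⟩ : LabOp T.toCollection H (w.src (ρ j))))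
      fun j => can (w.lab (ρ j)) (τ j) (x j) (γ j))) =
      (M.prod (T.comp (T.act w.op ρ) fun j => T.act (w.lab (ρ j)).op (τ j))).map
          (X := concat x) (Y := concat fun j k => (w.lab (ρ j)).lab (τ j k)) (concat γ) ≫
        eqToHom (congrArg M.toProducts.ev
          (lab_equivariance w.op (fun j => (w.lab j).op) ρ τ fun j => (w.lab j).lab)) ≫
        (M.ξ (T.comp w.op fun j => (w.lab j).op) (blockPerm ρ τ)).app
          (concat fun j => (w.lab j).lab) := by
  refine (Category.assoc _ _ _).symm.trans (Eq.trans ?_ (Category.assoc _ _ _))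
  refine congrArg (fun e => e ≫ _) (eq_of_heq ?_)
  refine HEq.trans (eqToHom_comp_heq _ _) (HEq.trans ?_ (comp_eqToHom_heq _ _).symm)
  refine M.toProducts.map_heq (T.equivariance w.op (fun j => (w.lab j).op) ρ τ).symm _ _ ?_
  intro p q h
  obtain rfl := Fin.ext h
  exact (pullHom_comp_eqToHom (r := (join w).tot (blockPerm ρ τ p))
    (γ (finSigmaFinEquiv.symm p).1 (finSigmaFinEquiv.symm p).2)
    (congrArg (tot₂ w) (finSigmaFinEquiv.symm_apply_apply (⟨ρ _, τ _ _⟩ :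
      (j : Fin w.arity) × Fin (w.lab j).arity))).symm).symm

theorem subst_natural {z w : LabOp T.toCollection (fam T.toCollection H) i} (f : z ⟶ w) :
    M.actMap ((map M.famAct i).map f) ≫ M.subst w = M.subst z ≫ M.actMap (joinMap f) := by
  obtain ⟨n, ρ, z', f', hf⟩ := exists_can f
  cases hf
  choose m τ x γ h using fun j => exists_can (f' j)
  obtain ⟨G, rfl, rfl⟩ : ∃ G : (j : Fin n) → Σ a, LabOp.Hom a (w.lab (ρ j)),
      (fun j => (G j).1) = z' ∧ HEq (fun j => (G j).2) f' :=
    ⟨fun j => ⟨z' j, f' j⟩, rfl, HEq.rfl⟩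
  obtain rfl : G = fun j => ⟨⟨T.act (w.lab (ρ j)).op (τ j), x j⟩, can (w.lab (ρ j)) (τ j) (x j) (γ j)⟩ :=
    funext h
  exact subst_aux
    (M.actMap_can ⟨w.op, fun j => M.toProducts.ev (w.lab j)⟩ ρ
      (fun j => (M.prod (T.act (w.lab (ρ j)).op (τ j))).obj (x j))
      (fun j => M.actMap (can (w.lab (ρ j)) (τ j) (x j) (γ j))))
    ((congrArg (fun g => (M.prod (T.act w.op ρ)).map g)
      (funext fun j => M.actMap_can (w.lab (ρ j)) (τ j) (x j) (γ j))).trans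
      ((M.prod (T.act w.op ρ)).map_comp
        (X := fun j => (M.prod (T.act (w.lab (ρ j)).op (τ j))).obj (x j))
        (fun j => (M.prod (T.act (w.lab (ρ j)).op (τ j))).map (γ j))
        (fun j => (M.ξ (w.lab (ρ j)).op (τ j)).app (w.lab (ρ j)).lab)))
    (M.ξ_σ w.op (fun j => (w.lab j).op) ρ τ fun j => (w.lab j).lab)
    ((M.σ (T.act w.op ρ) fun j => T.act (w.lab (ρ j)).op (τ j)).naturality
      (X := x) (Y := fun j k => (w.lab (ρ j)).lab (τ j k)) γ)
    (M.actMap_joinMap_can w ρ τ x γ)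

/-- The 2-cell `1 ⟶ a η` given by the units `ν`. -/
def coh₀ : 𝟙 H ⟶ famUnit T H ≫ M.famAct := fun i =>
  { app := fun x => (M.ν i).app x
    naturality := fun x y g => ((M.ν i).naturality g).trans
      (congrArg (fun e => _ ≫ e)
        (M.actMap_level ⟨T.one i, fun _ => x⟩ (fun _ => y) (fun _ => g) (arrow_one _)).symm) }

/-- The 2-cell `a T(a) ⟶ a μ` given by the substitutions `σ`. -/
def coh₂ : famMap T.toCollection M.famAct ≫ M.famAct ⟶ famMult T H ≫ M.famAct := fun _ =>
  { app := fun z => M.subst z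
    naturality := fun _ _ f => M.subst_natural f }

/-- The lax algebra of the 2-monad of `T` which corresponds to a lax morphism `T → Cat`. -/
def toLaxAlgebra : T.twoMonad.LaxAlgebra H where
  a := M.famAct
  a₀ := M.coh₀
  a₂ := M.coh₂
  unit_left := FamCat.hom₂_ext fun i x =>
    (FamCat.comp₅_app _ _ _ _ _ i x).trans (unit_aux _ _ _ _ _
      ((congrArg (fun e => _ ≫ e) (Category.id_comp _)).trans (M.ν_prod x.op x.lab)))
  unit_right := FamCat.hom₂_ext fun i x =>
    (FamCat.comp₅_app _ _ _ _ _ i x).trans (unit_aux _ _ _ _ _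
      ((congrArg₂ (fun e e' => e ≫ e')
        (M.actMap_level x _ (fun j => (M.ν (x.src j)).app (x.lab j)) (arrow_one _))
        (Category.id_comp _)).trans (M.prod_ν x.op x.lab)))
  assoc := FamCat.hom₂_ext fun i z => by
    refine (FamCat.comp₃_app _ _ _ i z).trans (Eq.trans ?_ (FamCat.comp₅_app _ _ _ _ _ i z).symm)
    exact assoc_aux _ _ _ _
      (M.actMap_level ⟨z.op, fun j => M.toProducts.ev ((map M.famAct _).obj (z.lab j))⟩
        (fun j => M.toProducts.ev (join (z.lab j))) (fun j => M.subst (z.lab j)) (arrow_one _))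
      (M.σ_σ z.op (fun j => (z.lab j).op) (fun j k => ((z.lab j).lab k).op)
        fun j k => ((z.lab j).lab k).lab)

end action

end LaxOperadMorphism

/-! A 2-cell between `b T(f)` and `f a` is a family, natural over each category `(TH)_i`, of
morphisms indexed by the labelled operations `(α, y)`. Fixing `α` and letting `y` vary cuts it into
the families `f̄_α`, and no data is lost, since a labelled operation is nothing but such a pair. It
remains to match the conditions.

Naturality over `(TH)_i` has two sources. By `exists_can` every morphism into `b = (β, y)` has the
form `(ρ, γ) : (βρ, x) ⟶ (β, y)`. It is a change of labels along `γ` with identity permutation,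
followed by the permutation `ρ` with identity labels. The action sends the first factor to
`H_{βρ}(γ)` (`actMap_level'`) and the second to `ξ_{β,ρ}` (`actMap_can_id`). Thus naturality of the
whole family amounts to naturality of each `f̄_α` together with compatibility with `ξ`. One
direction is `LaxCell.component` and `LaxCell.component_ξ`, the other is `LaxCell.mk`.

The two algebra axioms are equations of 2-cells, so they are tested on objects. At `x` the unit
axiom becomes the axiom for `ν` at `(1_i, (x))` (`LaxCell.unit_iff`). At an object `(α, (β_j,
x_j)_j)` of `T²H` the multiplication axiom becomes the axiom for `σ` (`LaxCell.mult_iff`). The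
canonical isomorphisms in these axioms have identity components, because the functors they relate
agree on objects by definition.

The colax case reverses the cells. Pseudo and strict structures are lax ones with a property of the
cell, and each property can be tested on components (`LaxCell.isIso_iff`,
`LaxCell.exists_component_eq`, `LaxCell.exists_eq_eqToHom`). The lax bijection therefore restricts
to them. -/

namespace FamCat

/-! ### Componentwise tests for 2-cells of `Cat/I`, and evaluation of pasted 2-cells. -/

variable {I : Type u} {X Y : FamCat I} {F F' G G' L L' P P' : X ⟶ Y}

theorem isIso_iff (θ : F ⟶ G) : IsIso θ ↔ ∀ i x, IsIso ((θ i).app x) := by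
  refine ⟨fun _ i x => ⟨(inv θ i).app x, ?_, ?_⟩, fun h => ?_⟩
  · exact congrArg (fun φ : F ⟶ F => (φ i).app x) (IsIso.hom_inv_id θ)
  · exact congrArg (fun φ : G ⟶ G => (φ i).app x) (IsIso.inv_hom_id θ)
  · have h' : ∀ i, IsIso (θ i) := fun i => (NatTrans.isIso_iff_isIso_app (θ i)).2 (h i)
    exact (isoMk fun i => asIso (θ i)).isIso_hom

/-- Equality on objects alone would not make the functors equal. Naturality of `θ` supplies the
rest: when its components are canonical isomorphisms, each naturality square says that `F` and `G`
agree on arrows up to these isomorphisms, which is the hypothesis of `Functor.ext`. -/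
theorem _root_.CategoryTheory.NatTrans.exists_eq_eqToHom {C D : Type*} [Category* C] [Category* D]
    {F G : C ⥤ D} (θ : F ⟶ G) (h : ∀ x, ∃ e : F.obj x = G.obj x, θ.app x = eqToHom e) :
    ∃ e : F = G, θ = eqToHom e := by
  choose e he using h
  refine ⟨CategoryTheory.Functor.ext e fun x y g => ?_, ?_⟩
  · have := θ.naturality g
    rw [he, he] at this
    rw [← reassoc_of% this, eqToHom_trans, eqToHom_refl, Category.comp_id]
  · ext x
    rw [he, CategoryTheory.eqToHom_app]

theorem exists_eq_eqToHom (θ : F ⟶ G)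
    (h : ∀ i x, ∃ e : (F i).obj x = (G i).obj x, (θ i).app x = eqToHom e) :
    ∃ e : F = G, θ = eqToHom e := by
  choose e he using fun i => NatTrans.exists_eq_eqToHom (θ i) (h i)
  exact ⟨funext e, hom₂_ext fun i x => by rw [he, CategoryTheory.eqToHom_app, eqToHom_app]⟩

/-- This and the next three lemmas evaluate the strings of 2-cells found in the morphism axioms; the
index counts the 2-cells that are not canonical. The 1-cells are kept as variables so that the
equations between them can be eliminated by `subst`, which concrete equations such as `T(fg) =
T(f)T(g)` do not allow. -/
theorem comp_eqToHom₁_app (e₁ : F = F') (θ : F' ⟶ G) (e₂ : G = G') (i : I) (x : X i) :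
    ((eqToHom e₁ ≫ θ ≫ eqToHom e₂) i).app x =
      eqToHom (congrArg (fun F : X ⟶ Y => (F i).obj x) e₁) ≫ (θ i).app x ≫
        eqToHom (congrArg (fun F : X ⟶ Y => (F i).obj x) e₂) := by
  subst e₁ e₂; rfl

theorem comp_eqToHom₂_app (e₁ : F = F') (θ : F' ⟶ G) (e₂ : G = G') (φ : G' ⟶ L) (i : I)
    (x : X i) :
    ((eqToHom e₁ ≫ θ ≫ eqToHom e₂ ≫ φ) i).app x =
      eqToHom (congrArg (fun F : X ⟶ Y => (F i).obj x) e₁) ≫ (θ i).app x ≫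
        eqToHom (congrArg (fun F : X ⟶ Y => (F i).obj x) e₂) ≫ (φ i).app x := by
  subst e₁ e₂; rfl

theorem comp_eqToHom₃_app (e₁ : F = F') (θ : F' ⟶ G) (e₂ : G = G') (φ : G' ⟶ L) (e₃ : L = L')
    (ψ : L' ⟶ P) (e₄ : P = P') (i : I) (x : X i) :
    ((eqToHom e₁ ≫ θ ≫ eqToHom e₂ ≫ φ ≫ eqToHom e₃ ≫ ψ ≫ eqToHom e₄) i).app x =
      eqToHom (congrArg (fun F : X ⟶ Y => (F i).obj x) e₁) ≫ (θ i).app x ≫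
        eqToHom (congrArg (fun F : X ⟶ Y => (F i).obj x) e₂) ≫ (φ i).app x ≫
          eqToHom (congrArg (fun F : X ⟶ Y => (F i).obj x) e₃) ≫ (ψ i).app x ≫
            eqToHom (congrArg (fun F : X ⟶ Y => (F i).obj x) e₄) := by
  subst e₁ e₂ e₃ e₄; rfl

theorem comp_eqToHom₃_app' (θ : F ⟶ G) (e₁ : G = G') (φ : G' ⟶ L) (e₂ : L = L')
    (ψ : L' ⟶ P) (e₃ : P = P') (i : I) (x : X i) :
    ((θ ≫ eqToHom e₁ ≫ φ ≫ eqToHom e₂ ≫ ψ ≫ eqToHom e₃) i).app x =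
      (θ i).app x ≫
        eqToHom (congrArg (fun F : X ⟶ Y => (F i).obj x) e₁) ≫ (φ i).app x ≫
          eqToHom (congrArg (fun F : X ⟶ Y => (F i).obj x) e₂) ≫ (ψ i).app x ≫
            eqToHom (congrArg (fun F : X ⟶ Y => (F i).obj x) e₃) := by
  subst e₁ e₂ e₃; rfl

section

variable {C : Type*} [Category* C] {A B D E : C}

/-- After evaluation at an object, the equations of 1-cells used below become equations between
definitionally equal objects. These lemmas then apply up to unfolding and discard the canonical
isomorphisms. -/
theorem eqToHom_self₁ (e₁ : A = A) (e₂ : B = B) (p : A ⟶ B) :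
    eqToHom e₁ ≫ p ≫ eqToHom e₂ = p := by simp

theorem eqToHom_self₂ (e₁ : A = A) (e₂ : B = B) (p : A ⟶ B) (q : B ⟶ D) :
    eqToHom e₁ ≫ p ≫ eqToHom e₂ ≫ q = p ≫ q := by simp

theorem eqToHom_self₃ (e₁ : A = A) (e₂ : B = B) (e₃ : D = D) (e₄ : E = E) (p : A ⟶ B) (q : B ⟶ D)
    (r : D ⟶ E) :
    eqToHom e₁ ≫ p ≫ eqToHom e₂ ≫ q ≫ eqToHom e₃ ≫ r ≫ eqToHom e₄ = p ≫ q ≫ r := by simp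

theorem eqToHom_self₃' (e₁ : B = B) (e₂ : D = D) (e₃ : E = E) (p : A ⟶ B) (q : B ⟶ D)
    (r : D ⟶ E) : p ≫ eqToHom e₁ ≫ q ≫ eqToHom e₂ ≫ r ≫ eqToHom e₃ = p ≫ q ≫ r := by simp

end

end FamCat

open LabOp

/-! ### The action on the two kinds of morphisms that generate `TH`: changes of labels and
permutations. -/

namespace LaxOperadMorphism

variable {I : Type u} {T : SymOperad I} {H K : FamCat I} {i : I} (M : LaxOperadMorphism T H)
  (N : LaxOperadMorphism T K) (f : H ⟶ K)

/-- The 2-cells `b T(f) ⟶ f a`. -/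
abbrev LaxCell := famMap T.toCollection f ≫ N.famAct ⟶ M.famAct ≫ f

/-- The 2-cells `f a ⟶ b T(f)`. -/
abbrev ColaxCell := M.famAct ≫ f ⟶ famMap T.toCollection f ≫ N.famAct

variable {M N f}

/-- The morphism of labelled operations given by morphisms of labels. -/
def level {n : ℕ} {c : Fin n → I} (α : T.Hom c i) {x y : ∀ j, H (c j)} (γ : ∀ j, x j ⟶ y j) :
    (⟨α, x⟩ : LabOp T.toCollection H i) ⟶ ⟨α, y⟩ :=
  ⟨Equiv.refl (Fin n), arrow_one ⟨α, x⟩, fun j => Sigma.SigmaHom.mk (γ j)⟩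

/-- The underlying permutation is the identity, so by `ξ_one` the symmetry contributes only a
canonical isomorphism. -/
theorem actMap_level' {n : ℕ} {c : Fin n → I} (α : T.Hom c i) {x y : ∀ j, H (c j)}
    (γ : ∀ j, x j ⟶ y j) : M.actMap (level α γ) = (M.prod α).map γ :=
  M.actMap_level ⟨α, x⟩ y γ _

/-- `T f` keeps the operation and applies `f` to the labels, so by definition it sends level
morphisms to level morphisms. -/
theorem actMap_map_level {n : ℕ} {c : Fin n → I} (α : T.Hom c i) {x y : ∀ j, H (c j)}
    (γ : ∀ j, x j ⟶ y j) :
    N.actMap ((LabOp.map f i).map (level α γ)) =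
      (N.prod α).map (X := fun j => (f (c j)).obj (x j)) (fun j => (f (c j)).map (γ j)) :=
  actMap_level' (M := N) α fun j => (f (c j)).map (γ j)

/-- The complementary case to `actMap_level'`: with identity labels the factor `H_{αρ}(γ)` is an
identity, and the symmetry alone remains. -/
theorem actMap_can_id {n m : ℕ} {c : Fin n → I} (α : T.Hom c i) (ρ : Fin m ≃ Fin n)
    (x : ∀ j, H (c j)) :
    M.actMap (can ⟨α, x⟩ ρ (fun j => x (ρ j)) fun j => 𝟙 (x (ρ j))) = (M.ξ α ρ).app x :=
  (M.actMap_can ⟨α, x⟩ ρ (fun j => x (ρ j)) fun j => 𝟙 (x (ρ j))).trans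
    ((congrArg (fun e => e ≫ (M.ξ α ρ).app x)
      ((M.prod (T.act α ρ)).map_id fun j => x (ρ j))).trans (Category.id_comp _))

theorem actMap_map_can {b : LabOp T.toCollection H i} {m : ℕ} (ρ : Fin m ≃ Fin b.arity)
    (x : ∀ j, H (b.src (ρ j))) (γ : ∀ j, x j ⟶ b.lab (ρ j)) :
    N.actMap ((LabOp.map f i).map (can b ρ x γ)) =
      (N.prod (T.act b.op ρ)).map (X := fun j => (f _).obj (x j)) (fun j => (f _).map (γ j)) ≫
        (N.ξ b.op ρ).app fun j => (f _).obj (b.lab j) :=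
  N.actMap_can ((LabOp.map f i).obj b) ρ (fun j => (f _).obj (x j)) fun j => (f _).map (γ j)

theorem actMap_map_can_id {n m : ℕ} {c : Fin n → I} (α : T.Hom c i) (ρ : Fin m ≃ Fin n)
    (x : ∀ j, H (c j)) :
    N.actMap ((LabOp.map f i).map (can ⟨α, x⟩ ρ (fun j => x (ρ j)) fun j => 𝟙 (x (ρ j)))) =
      (N.ξ α ρ).app fun j => (f _).obj (x j) := by
  refine (actMap_map_can (b := ⟨α, x⟩) ρ _ _).trans ?_
  -- The image under `T f` carries the labels `f(1)` and not `1`, so `actMap_can_id` for `N` does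
  -- not apply directly. Both sides are expanded by `actMap_can` and compared through functoriality
  -- of `f`.
  refine Eq.trans ?_ (actMap_can_id (M := N) α ρ fun j => (f _).obj (x j))
  refine Eq.trans ?_ (N.actMap_can ⟨α, fun j => (f _).obj (x j)⟩ ρ _ _).symm
  exact congrArg (fun g => (N.prod (T.act α ρ)).map g ≫ _)
    (funext fun j => (f (c (ρ j))).map_id (x (ρ j)))

/-! ### Lax morphisms and lax-natural transformations. -/

section lax

/-- The component of a 2-cell `b T(f) ⟶ f a` at an arrow of `T`. -/
def LaxCell.component (θ : LaxCell M N f) {n : ℕ} {c : Fin n → I} (α : T.Hom c i) :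
    Functor.pi (fun j => f (c j)) ⋙ N.prod α ⟶ M.prod α ⋙ f i where
  app y := (θ i).app ⟨α, y⟩
  -- This is the naturality square of `θ` at the level morphism with labels `γ`.
  naturality x y γ :=
    (congrArg (fun e => e ≫ (θ i).app ⟨α, y⟩) (actMap_map_level α γ)).symm.trans
      (((θ i).naturality (level α γ)).trans
        (congrArg (fun e => (θ i).app ⟨α, x⟩ ≫ (f i).map e) (actMap_level' α γ)))

/-- The naturality square of `θ` at the morphism with permutation `ρ` and identity labels. -/
theorem LaxCell.component_ξ (θ : LaxCell M N f) {m n : ℕ} {c : Fin n → I} (α : T.Hom c i)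
    (ρ : Fin m ≃ Fin n) (x : ∀ j, H (c j)) :
    (θ.component (T.act α ρ)).app (fun j => x (ρ j)) ≫ (f i).map ((M.ξ α ρ).app x) =
      (N.ξ α ρ).app (fun j => (f (c j)).obj (x j)) ≫ (θ.component α).app x :=
  (congrArg (fun e => (θ i).app ⟨T.act α ρ, fun j => x (ρ j)⟩ ≫ (f i).map e)
    (actMap_can_id α ρ x)).symm.trans
    (((θ i).naturality (can ⟨α, x⟩ ρ (fun j => x (ρ j)) fun j => 𝟙 (x (ρ j)))).symm.trans
      (congrArg (fun e => e ≫ (θ i).app ⟨α, x⟩) (actMap_map_can_id α ρ x)))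

/-- The 2-cell `b T(f) ⟶ f a` with given components. -/
def LaxCell.mk (t : ∀ {n : ℕ} {c : Fin n → I} {i : I} (α : T.Hom c i),
      Functor.pi (fun j => f (c j)) ⋙ N.prod α ⟶ M.prod α ⋙ f i)
    (h : ∀ {m n : ℕ} {c : Fin n → I} {i : I} (α : T.Hom c i) (ρ : Fin m ≃ Fin n)
      (x : ∀ j, H (c j)),
      (t (T.act α ρ)).app (fun j => x (ρ j)) ≫ (f i).map ((M.ξ α ρ).app x) =
        (N.ξ α ρ).app (fun j => (f (c j)).obj (x j)) ≫ (t α).app x) : LaxCell M N f := fun i =>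
  { app := fun a => (t a.op).app a.lab
    naturality := fun a b g => by
      -- The source and the morphism are replaced together, as a pair in a sigma type: the type of
      -- `g` depends on `a`, so neither can be rewritten alone.
      obtain ⟨m, ρ, x, γ, hg⟩ := exists_can g
      cases hg
      -- The action sends `g` to `H_{βρ}(γ)` followed by `ξ_{β,ρ}`. The square for `g` is therefore
      -- the pasting of the square `h₁` for the labels with the square `h₂` for the permutation.
      have h₁ := (t (T.act b.op ρ)).naturality (X := x) (Y := fun j => b.lab (ρ j)) γ
      have h₂ := h b.op ρ b.lab
      refine (congrArg (fun e => e ≫ (t b.op).app b.lab) (actMap_map_can ρ x γ)).trans ?_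
      refine Eq.trans ?_ (congrArg (fun e => (t (T.act b.op ρ)).app x ≫ (f i).map e)
        (M.actMap_can b ρ x γ)).symm
      refine Eq.trans ?_ (congrArg (fun e => (t (T.act b.op ρ)).app x ≫ e)
        ((f i).map_comp ((M.prod (T.act b.op ρ)).map γ) ((M.ξ b.op ρ).app b.lab))).symm
      refine (Category.assoc _ _ _).trans ?_
      refine (congrArg (fun e => _ ≫ e) h₂.symm).trans ?_
      refine (Category.assoc _ _ _).symm.trans ?_
      exact (congrArg (fun e => e ≫ _) h₁).trans (Category.assoc _ _ _) }

/-- Since `η` sends `x` to `(1_i, (x))`, the whiskered cell has at `x` the component of `θ` at that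
labelled operation. The 2-cells of the two algebra units have the components of `ν`. -/
theorem LaxCell.unit_iff (θ : LaxCell M N f) :
    (eqToHom (Strict.comp_id f).symm ≫ f ◁ N.toLaxAlgebra.a₀ ≫
        eqToHom (T.twoMonad.eq_η f N.toLaxAlgebra.a) ≫ T.twoMonad.η H ◁ θ =
      eqToHom (Strict.id_comp f).symm ≫ M.toLaxAlgebra.a₀ ▷ f ≫ eqToHom (Strict.assoc _ _ _)) ↔
    ∀ (i : I) (x : H i),
      (N.ν i).app ((f i).obj x) ≫ (θ.component (T.one i)).app (fun _ => x) =
        (f i).map ((M.ν i).app x) := by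
  refine FamCat.hom₂_ext_iff.trans (forall₂_congr fun i x => ?_)
  refine Eq.congr ?_ ?_
  · exact (FamCat.comp_eqToHom₂_app _ _ _ _ i x).trans (FamCat.eqToHom_self₂ _ _ _ _)
  · exact (FamCat.comp_eqToHom₁_app _ _ _ i x).trans (FamCat.eqToHom_self₁ _ _ _)

/-- Both sides are evaluated at an object `z` of `T²H`, and `z` consists exactly of an arrow `α`
with arrows `β_j` and labels `x_jk`. The multiplication `μ` joins `z` to `(α(β_j)_j, (x_jk))`, which
produces the cell at the composite. -/
theorem LaxCell.mult_iff (θ : LaxCell M N f) :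
    (T.twoMonad.map (T.twoMonad.map f) ◁ N.toLaxAlgebra.a₂ ≫
        eqToHom (T.twoMonad.eq_μ f N.toLaxAlgebra.a) ≫ T.twoMonad.μ H ◁ θ =
      eqToHom (T.twoMonad.eq_map_comp (T.twoMonad.map f) N.toLaxAlgebra.a
          N.toLaxAlgebra.a).symm ≫ T.twoMonad.map₂ θ ▷ N.toLaxAlgebra.a ≫
        eqToHom (T.twoMonad.eq_map_comp M.toLaxAlgebra.a f N.toLaxAlgebra.a) ≫
          T.twoMonad.map M.toLaxAlgebra.a ◁ θ ≫
          eqToHom (Strict.assoc _ _ _).symm ≫ M.toLaxAlgebra.a₂ ▷ f ≫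
            eqToHom (Strict.assoc _ _ _)) ↔
    ∀ {n : ℕ} {c : Fin n → I} {i : I} (α : T.Hom c i) {m : Fin n → ℕ}
      {d : (j : Fin n) → Fin (m j) → I} (β : ∀ j, T.Hom (d j) (c j)) (x : ∀ j k, H (d j k)),
      (N.σ α β).app (fun j k => (f (d j k)).obj (x j k)) ≫
          (θ.component (T.comp α β)).app (concat x) =
        (N.prod α).map (fun j => (θ.component (β j)).app (x j)) ≫
          (θ.component α).app (fun j => (M.prod (β j)).obj (x j)) ≫
            (f i).map ((M.σ α β).app x) := by
  refine FamCat.hom₂_ext_iff.trans ?_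
  refine Iff.trans (b := ∀ i (z : LabOp T.toCollection (fam T.toCollection H) i),
    N.subst ((LabOp.map (famMap T.toCollection f) i).obj z) ≫ (θ i).app (join z) =
      (N.prod z.op).map (fun j => (θ (z.src j)).app (z.lab j)) ≫
        (θ i).app ⟨z.op, fun j => M.toProducts.ev (z.lab j)⟩ ≫ (f i).map (M.subst z)) ?_
    -- Passing between `z` and the data `α`, `β`, `x` only packs and unpacks structures, so both
    -- directions hold by definition.
    ⟨fun h n c i α m d β x => h i ⟨α, fun j => ⟨β j, x j⟩⟩,
      fun h i z => h z.op (fun j => (z.lab j).op) fun j => (z.lab j).lab⟩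
  refine forall₂_congr fun i z => Eq.congr ?_ ?_
  · exact (FamCat.comp₃_app _ _ _ i z).trans (congrArg (fun e => _ ≫ e) (Category.id_comp _))
  · refine (FamCat.comp_eqToHom₃_app _ _ _ _ _ _ _ i z).trans
      ((FamCat.eqToHom_self₃ _ _ _ _ _ _ _).trans ?_)
    -- The component of `T θ` at `z` is a level morphism whose labels are components of `θ`, so the
    -- action of `N` on it is `K_α` applied to those components.
    exact congrArg (fun e => e ≫ _) (actMap_level' z.op fun j => (θ (z.src j)).app (z.lab j))

/-- Lax morphisms of algebras correspond to lax-natural transformations. -/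
def laxEquiv : TwoMonad.LaxMorphism M.toLaxAlgebra N.toLaxAlgebra f ≃ LaxNatural M N f where
  toFun φ :=
    { cell := fun α => LaxCell.component φ.cell α
      cell_ξ := LaxCell.component_ξ φ.cell
      cell_ν := (LaxCell.unit_iff φ.cell).1 φ.unit
      cell_σ := (LaxCell.mult_iff φ.cell).1 φ.mult }
  invFun t :=
    { cell := LaxCell.mk t.cell t.cell_ξ
      unit := (LaxCell.unit_iff (LaxCell.mk t.cell t.cell_ξ)).2 t.cell_ν
      mult := (LaxCell.mult_iff (LaxCell.mk t.cell t.cell_ξ)).2 t.cell_σ }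
  -- Both composites return the same components, because a labelled operation equals the pair of its
  -- operation and its labels by eta for structures. The remaining fields are propositions.
  left_inv _ := rfl
  right_inv _ := rfl

end lax

/-! ### Colax morphisms and colax-natural transformations: the same argument with the cells
reversed. -/

section colax

/-- The component of a 2-cell `f a ⟶ b T(f)` at an arrow of `T`. -/
def ColaxCell.component (θ : ColaxCell M N f) {n : ℕ} {c : Fin n → I} (α : T.Hom c i) :
    M.prod α ⋙ f i ⟶ Functor.pi (fun j => f (c j)) ⋙ N.prod α where
  app y := (θ i).app ⟨α, y⟩
  naturality x y γ :=
    (congrArg (fun e => (f i).map e ≫ (θ i).app ⟨α, y⟩) (actMap_level' α γ)).symm.trans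
      (((θ i).naturality (level α γ)).trans
        (congrArg (fun e => (θ i).app ⟨α, x⟩ ≫ e) (actMap_map_level α γ)))

/-- Again naturality at a permutation with identity labels; now `ξ` of `K` follows the cell and `ξ`
of `H` precedes it. -/
theorem ColaxCell.component_ξ (θ : ColaxCell M N f) {m n : ℕ} {c : Fin n → I} (α : T.Hom c i)
    (ρ : Fin m ≃ Fin n) (x : ∀ j, H (c j)) :
    (θ.component (T.act α ρ)).app (fun j => x (ρ j)) ≫
        (N.ξ α ρ).app (fun j => (f (c j)).obj (x j)) =
      (f i).map ((M.ξ α ρ).app x) ≫ (θ.component α).app x :=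
  (congrArg (fun e => (θ i).app ⟨T.act α ρ, fun j => x (ρ j)⟩ ≫ e)
    (actMap_map_can_id α ρ x)).symm.trans
    (((θ i).naturality (can ⟨α, x⟩ ρ (fun j => x (ρ j)) fun j => 𝟙 (x (ρ j)))).symm.trans
      (congrArg (fun e => (f i).map e ≫ (θ i).app ⟨α, x⟩) (actMap_can_id α ρ x)))

/-- The 2-cell `f a ⟶ b T(f)` with given components. -/
def ColaxCell.mk (t : ∀ {n : ℕ} {c : Fin n → I} {i : I} (α : T.Hom c i),
      M.prod α ⋙ f i ⟶ Functor.pi (fun j => f (c j)) ⋙ N.prod α)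
    (h : ∀ {m n : ℕ} {c : Fin n → I} {i : I} (α : T.Hom c i) (ρ : Fin m ≃ Fin n)
      (x : ∀ j, H (c j)),
      (t (T.act α ρ)).app (fun j => x (ρ j)) ≫ (N.ξ α ρ).app (fun j => (f (c j)).obj (x j)) =
        (f i).map ((M.ξ α ρ).app x) ≫ (t α).app x) : ColaxCell M N f := fun i =>
  { app := fun a => (t a.op).app a.lab
    naturality := fun a b g => by
      obtain ⟨m, ρ, x, γ, hg⟩ := exists_can g
      cases hg
      -- As in the lax case, the square for the permutation is pasted to the square for the labels.
      have h₁ := (t (T.act b.op ρ)).naturality (X := x) (Y := fun j => b.lab (ρ j)) γ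
      have h₂ := h b.op ρ b.lab
      refine Eq.trans ?_ (congrArg (fun e => (t (T.act b.op ρ)).app x ≫ e)
        (actMap_map_can ρ x γ)).symm
      refine (congrArg (fun e => (f i).map e ≫ (t b.op).app b.lab) (M.actMap_can b ρ x γ)).trans ?_
      refine (congrArg (fun e => e ≫ (t b.op).app b.lab)
        ((f i).map_comp ((M.prod (T.act b.op ρ)).map γ) ((M.ξ b.op ρ).app b.lab))).trans ?_
      refine (Category.assoc _ _ _).trans ?_
      refine (congrArg (fun e => _ ≫ e) h₂.symm).trans ?_
      refine (Category.assoc _ _ _).symm.trans ?_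
      exact (congrArg (fun e => e ≫ _) h₁).trans (Category.assoc _ _ _) }

theorem ColaxCell.unit_iff (θ : ColaxCell M N f) :
    (eqToHom (Strict.id_comp f).symm ≫ M.toLaxAlgebra.a₀ ▷ f ≫ eqToHom (Strict.assoc _ _ _) ≫
        T.twoMonad.η H ◁ θ =
      eqToHom (Strict.comp_id f).symm ≫ f ◁ N.toLaxAlgebra.a₀ ≫
        eqToHom (T.twoMonad.eq_η f N.toLaxAlgebra.a)) ↔
    ∀ (i : I) (x : H i),
      (f i).map ((M.ν i).app x) ≫ (θ.component (T.one i)).app (fun _ => x) =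
        (N.ν i).app ((f i).obj x) := by
  refine FamCat.hom₂_ext_iff.trans (forall₂_congr fun i x => ?_)
  refine Eq.congr ?_ ?_
  · exact (FamCat.comp_eqToHom₂_app _ _ _ _ i x).trans (FamCat.eqToHom_self₂ _ _ _ _)
  · exact (FamCat.comp_eqToHom₁_app _ _ _ i x).trans (FamCat.eqToHom_self₁ _ _ _)

/-- Evaluation at an object of `T²H`, as for lax cells. The outer cell at `α` now comes before the
inner cells at the `β_j`, and `σ` of `K` comes last. -/
theorem ColaxCell.mult_iff (θ : ColaxCell M N f) :
    (eqToHom (Strict.assoc _ _ _).symm ≫ M.toLaxAlgebra.a₂ ▷ f ≫ eqToHom (Strict.assoc _ _ _) ≫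
        T.twoMonad.μ H ◁ θ =
      T.twoMonad.map M.toLaxAlgebra.a ◁ θ ≫
        eqToHom (T.twoMonad.eq_map_comp M.toLaxAlgebra.a f N.toLaxAlgebra.a).symm ≫
          T.twoMonad.map₂ θ ▷ N.toLaxAlgebra.a ≫
            eqToHom (T.twoMonad.eq_map_comp (T.twoMonad.map f) N.toLaxAlgebra.a
              N.toLaxAlgebra.a) ≫
              T.twoMonad.map (T.twoMonad.map f) ◁ N.toLaxAlgebra.a₂ ≫
                eqToHom (T.twoMonad.eq_μ f N.toLaxAlgebra.a)) ↔
    ∀ {n : ℕ} {c : Fin n → I} {i : I} (α : T.Hom c i) {m : Fin n → ℕ}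
      {d : (j : Fin n) → Fin (m j) → I} (β : ∀ j, T.Hom (d j) (c j)) (x : ∀ j k, H (d j k)),
      (f i).map ((M.σ α β).app x) ≫ (θ.component (T.comp α β)).app (concat x) =
        (θ.component α).app (fun j => (M.prod (β j)).obj (x j)) ≫
          (N.prod α).map (fun j => (θ.component (β j)).app (x j)) ≫
            (N.σ α β).app (fun j k => (f (d j k)).obj (x j k)) := by
  refine FamCat.hom₂_ext_iff.trans ?_
  refine Iff.trans (b := ∀ i (z : LabOp T.toCollection (fam T.toCollection H) i),
    (f i).map (M.subst z) ≫ (θ i).app (join z) =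
      (θ i).app ⟨z.op, fun j => M.toProducts.ev (z.lab j)⟩ ≫
        (N.prod z.op).map (fun j => (θ (z.src j)).app (z.lab j)) ≫
          N.subst ((LabOp.map (famMap T.toCollection f) i).obj z)) ?_
    ⟨fun h n c i α m d β x => h i ⟨α, fun j => ⟨β j, x j⟩⟩,
      fun h i z => h z.op (fun j => (z.lab j).op) fun j => (z.lab j).lab⟩
  refine forall₂_congr fun i z => Eq.congr ?_ ?_
  · exact (FamCat.comp_eqToHom₂_app _ _ _ _ i z).trans (FamCat.eqToHom_self₂ _ _ _ _)
  -- This side begins with a whiskering of `θ` and not with a canonical isomorphism, hence the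
  -- primed variants.
  · refine (FamCat.comp_eqToHom₃_app' _ _ _ _ _ _ i z).trans
      ((FamCat.eqToHom_self₃' _ _ _ _ _ _).trans ?_)
    exact congrArg (fun e => _ ≫ e ≫ _)
      (actMap_level' z.op fun j => (θ (z.src j)).app (z.lab j))

/-- Colax morphisms of algebras correspond to colax-natural transformations. -/
def colaxEquiv : TwoMonad.ColaxMorphism M.toLaxAlgebra N.toLaxAlgebra f ≃ ColaxNatural M N f where
  toFun φ :=
    { cell := fun α => ColaxCell.component φ.cell α
      cell_ξ := ColaxCell.component_ξ φ.cell
      cell_ν := (ColaxCell.unit_iff φ.cell).1 φ.unit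
      cell_σ := (ColaxCell.mult_iff φ.cell).1 φ.mult }
  invFun t :=
    { cell := ColaxCell.mk t.cell t.cell_ξ
      unit := (ColaxCell.unit_iff (ColaxCell.mk t.cell t.cell_ξ)).2 t.cell_ν
      mult := (ColaxCell.mult_iff (ColaxCell.mk t.cell t.cell_ξ)).2 t.cell_σ }
  left_inv _ := rfl
  right_inv _ := rfl

end colax

/-! ### Pseudo and strict structures as properties of the lax cell. -/

section invertible

/-- Invertibility is pointwise on both sides, and the points are the same: the pairs `(α, y)`. -/
theorem LaxCell.isIso_iff (θ : LaxCell M N f) :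
    IsIso θ ↔ ∀ {n : ℕ} {c : Fin n → I} {i : I} (α : T.Hom c i), IsIso (θ.component α) :=
  (FamCat.isIso_iff θ).trans
    ⟨fun h _ _ i α => (NatTrans.isIso_iff_isIso_app _).2 fun y => h i ⟨α, y⟩,
      fun h _ a => (NatTrans.isIso_iff_isIso_app _).1 (h a.op) a.lab⟩

/-- Pseudo morphisms of algebras correspond to pseudo-natural transformations. -/
def pseudoEquiv :
    TwoMonad.PseudoMorphism M.toLaxAlgebra N.toLaxAlgebra f ≃ PseudoNatural M N f where
  toFun φ :=
    { laxEquiv φ.toLaxMorphism with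
      isIso_cell := (LaxCell.isIso_iff φ.cell).1 φ.isIso_cell }
  invFun t :=
    { laxEquiv.symm t.toLaxNatural with
      isIso_cell := (LaxCell.isIso_iff (LaxCell.mk t.cell t.cell_ξ)).2 t.isIso_cell }
  -- The added field is a proposition, so the round trips reduce to those of the lax bijection.
  left_inv _ := rfl
  right_inv _ := rfl

/-- An identity 2-cell has canonical isomorphisms as components at all `(α, y)`, and
`NatTrans.exists_eq_eqToHom` recovers the equality of functors for each `α`. That equality is part
of the conclusion because the statement that the cell is an identity needs it in order to be typed.
-/
theorem LaxCell.exists_component_eq (θ : LaxCell M N f)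
    (e : famMap T.toCollection f ≫ N.famAct = M.famAct ≫ f) (h : θ = eqToHom e)
    {n : ℕ} {c : Fin n → I} (α : T.Hom c i) :
    ∃ e : Functor.pi (fun j => f (c j)) ⋙ N.prod α = M.prod α ⋙ f i,
      θ.component α = eqToHom e := by
  subst h
  exact NatTrans.exists_eq_eqToHom _ fun y => ⟨_, FamCat.eqToHom_app e i ⟨α, y⟩⟩

/-- The equalities given for the separate `α` concern functors on products of fibres, so they are
used only on objects. On the arrows of `TH` that involve permutations, the two 1-cells agree because
`θ` is natural there. -/
theorem LaxCell.exists_eq_eqToHom (θ : LaxCell M N f)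
    (e : ∀ {n : ℕ} {c : Fin n → I} {i : I} (α : T.Hom c i),
      Functor.pi (fun j => f (c j)) ⋙ N.prod α = M.prod α ⋙ f i)
    (h : ∀ {n : ℕ} {c : Fin n → I} {i : I} (α : T.Hom c i), θ.component α = eqToHom (e α)) :
    ∃ e : famMap T.toCollection f ≫ N.famAct = M.famAct ≫ f, θ = eqToHom e :=
  FamCat.exists_eq_eqToHom θ fun _ a =>
    ⟨CategoryTheory.Functor.congr_obj (e a.op) a.lab, (congrArg (fun t => t.app a.lab) (h a.op)).trans
      (CategoryTheory.eqToHom_app (e a.op) a.lab)⟩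

/-- Strict morphisms of algebras correspond to natural transformations. -/
def strictEquiv :
    TwoMonad.StrictMorphism M.toLaxAlgebra N.toLaxAlgebra f ≃ StrictNatural M N f where
  toFun φ :=
    { laxEquiv φ.toLaxMorphism with
      -- The witness of this existential is itself a proof, so both of its parts can be projected
      -- into the fields.
      comm := fun α => (LaxCell.exists_component_eq φ.cell φ.comm φ.cell_eq α).1
      cell_eq := fun α => (LaxCell.exists_component_eq φ.cell φ.comm φ.cell_eq α).2 }
  invFun t :=
    { laxEquiv.symm t.toLaxNatural with
      comm := (LaxCell.exists_eq_eqToHom (LaxCell.mk t.cell t.cell_ξ) t.comm t.cell_eq).1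
      cell_eq := (LaxCell.exists_eq_eqToHom (LaxCell.mk t.cell t.cell_ξ) t.comm t.cell_eq).2 }
  left_inv _ := rfl
  right_inv _ := rfl

end invertible

end LaxOperadMorphism

theorem mainTheorem3 {I : Type u} (T : SymOperad I) {H K : FamCat I}
    (M : LaxOperadMorphism T H) (N : LaxOperadMorphism T K) (f : H ⟶ K) :
    (∃ e : TwoMonad.LaxMorphism M.toLaxAlgebra N.toLaxAlgebra f ≃ LaxNatural M N f,
      ∀ (φ : TwoMonad.LaxMorphism M.toLaxAlgebra N.toLaxAlgebra f) {n : ℕ} {c : Fin n → I} {i : I}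
        (α : T.Hom c i) (y : ∀ j, H (c j)), ((e φ).cell α).app y = (φ.cell i).app ⟨α, y⟩) ∧
    (∃ e : TwoMonad.ColaxMorphism M.toLaxAlgebra N.toLaxAlgebra f ≃ ColaxNatural M N f,
      ∀ (φ : TwoMonad.ColaxMorphism M.toLaxAlgebra N.toLaxAlgebra f) {n : ℕ} {c : Fin n → I}
        {i : I} (α : T.Hom c i) (y : ∀ j, H (c j)),
          ((e φ).cell α).app y = (φ.cell i).app ⟨α, y⟩) ∧
    (∃ e : TwoMonad.PseudoMorphism M.toLaxAlgebra N.toLaxAlgebra f ≃ PseudoNatural M N f,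
      ∀ (φ : TwoMonad.PseudoMorphism M.toLaxAlgebra N.toLaxAlgebra f) {n : ℕ} {c : Fin n → I}
        {i : I} (α : T.Hom c i) (y : ∀ j, H (c j)),
          ((e φ).cell α).app y = (φ.cell i).app ⟨α, y⟩) ∧
    (∃ e : TwoMonad.StrictMorphism M.toLaxAlgebra N.toLaxAlgebra f ≃ StrictNatural M N f,
      ∀ (φ : TwoMonad.StrictMorphism M.toLaxAlgebra N.toLaxAlgebra f) {n : ℕ} {c : Fin n → I}
        {i : I} (α : T.Hom c i) (y : ∀ j, H (c j)),
          ((e φ).cell α).app y = (φ.cell i).app ⟨α, y⟩) :=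
  ⟨⟨LaxOperadMorphism.laxEquiv, fun _ _ _ _ _ _ => rfl⟩,
    ⟨LaxOperadMorphism.colaxEquiv, fun _ _ _ _ _ _ => rfl⟩,
    ⟨LaxOperadMorphism.pseudoEquiv, fun _ _ _ _ _ _ => rfl⟩,
    ⟨LaxOperadMorphism.strictEquiv, fun _ _ _ _ _ _ => rfl⟩⟩
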